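/- Let $k$ be a finite field of characteristic $p$, let $G$ be a profinite group, and let $k[[G]]=\varprojlim_N k[G/N]$ be the completed group algebra, where $N$ runs over the open normal subgroups of $G$. A profinite $k[[G]]$-module is a profinite abelian group $U$ with a continuous map $k[[G]]\times U\to U$ satisfying the module axioms; it is indecomposable if it is non-zero and is not the direct sum of two non-zero closed submodules. For a closed subgroup $H\le G$, a profinite $k[[G]]$-module $U$ is relatively $H$-projective if, for every continuous surjective homomorphism $\beta\colon V\to W$ and every continuous homomorphism $\varphi\colon U\to W$ of profinite $k[[G]]$-modules, the existence of a continuous $k[[H]]$-module homomorphism $\rho'\colon U\to V$ with $\beta\rho'=\varphi$ implies the existence of a continuous $k[[G]]$-module homomorphism $\rho\colon U\to V$ with $\beta\rho=\varphi$. A vertex of $U$ is a closed subgroup $Q$ of $G$ such that $U$ is relatively $Q$-projective, but is not relatively $Q'$-projective for any proper closed subgroup $Q'$ of $Q$. Theorem. Let $U$ be a finitely generated indecomposable profinite $k[[G]]$-module. If $Q$ and $R$ are vertices of $U$, then there is $x\in G$ with $Q=xRx^{-1}$. Moreover, every vertex of $U$ is a pro-$p$ group. -/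

import Mathlib

universe u v w

section CompletedGroupAlgebraDefinition

variable (k : Type u) [Field k] (G : Type v) [Group G] [TopologicalSpace G]

/-- For open normal subgroups `N ≤ M` of `G`, the natural map `k[G/N] → k[G/M]`. -/
noncomputable def groupAlgebraTransition {N M : OpenNormalSubgroup G} (h : N ≤ M) :
    MonoidAlgebra k (G ⧸ (N : Subgroup G)) →ₐ[k] MonoidAlgebra k (G ⧸ (M : Subgroup G)) :=
  MonoidAlgebra.mapDomainAlgHom k k
    (QuotientGroup.map (N : Subgroup G) (M : Subgroup G) (MonoidHom.id G) h)

/-- The inverse limit of the group algebras `k[G/N]` over the open normal subgroups `N` of `G`,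
as a subalgebra of their product. -/
noncomputable def completedGroupSubalgebra :
    Subalgebra k (∀ N : OpenNormalSubgroup G, MonoidAlgebra k (G ⧸ (N : Subgroup G))) where
  carrier := {x | ∀ (N M : OpenNormalSubgroup G) (h : N ≤ M),
    groupAlgebraTransition k G h (x N) = x M}
  mul_mem' := fun ha hb N M h => by
    rw [Pi.mul_apply, Pi.mul_apply, map_mul, ha N M h, hb N M h]
  add_mem' := fun ha hb N M h => by
    rw [Pi.add_apply, Pi.add_apply, map_add, ha N M h, hb N M h]
  algebraMap_mem' := fun r N M h => by
    rw [Pi.algebraMap_apply, Pi.algebraMap_apply, AlgHom.commutes]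

/-- The completed group algebra `k[[G]]`. -/
def CompletedGroupAlgebra : Type (max u v) := completedGroupSubalgebra k G

namespace CompletedGroupAlgebra

noncomputable instance : Ring (CompletedGroupAlgebra k G) :=
  inferInstanceAs (Ring (completedGroupSubalgebra k G))

noncomputable instance : Algebra k (CompletedGroupAlgebra k G) :=
  inferInstanceAs (Algebra k (completedGroupSubalgebra k G))

/-- The projection `k[[G]] → k[G/N]`. -/
noncomputable def proj (N : OpenNormalSubgroup G) :
    CompletedGroupAlgebra k G →ₐ[k] MonoidAlgebra k (G ⧸ (N : Subgroup G)) :=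
  (Pi.evalAlgHom k (fun N : OpenNormalSubgroup G => MonoidAlgebra k (G ⧸ (N : Subgroup G))) N).comp
    (completedGroupSubalgebra k G).val

/-- The inverse limit topology on `k[[G]]`, where every `k[G/N]` is discrete: the coarsest topology
for which all projections are continuous. (It is the profinite topology of the completed group
algebra when `k` is finite and `G` is profinite.) -/
noncomputable instance : TopologicalSpace (CompletedGroupAlgebra k G) :=
  ⨅ N : OpenNormalSubgroup G, TopologicalSpace.induced (proj k G N) ⊥

variable {G}

/-- The open normal subgroup `N ∩ H` of a subgroup `H` of `G`. -/
def restrictOpenNormal (H : Subgroup G) (N : OpenNormalSubgroup G) : OpenNormalSubgroup H where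
  toOpenSubgroup := N.toOpenSubgroup.comap H.subtype continuous_subtype_val
  isNormal' := by
    change ((N : Subgroup G).comap H.subtype).Normal
    infer_instance

/-- The natural map `k[H/(N ∩ H)] → k[G/N]`. -/
noncomputable def finiteLevelInclusion (H : Subgroup G) (N : OpenNormalSubgroup G) :
    MonoidAlgebra k (H ⧸ (restrictOpenNormal H N : Subgroup H)) →ₐ[k]
      MonoidAlgebra k (G ⧸ (N : Subgroup G)) :=
  MonoidAlgebra.mapDomainAlgHom k k
    (QuotientGroup.map (restrictOpenNormal H N : Subgroup H) (N : Subgroup G) H.subtype le_rfl)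

/-- The algebra homomorphism `k[[H]] → k[[G]]` induced by the inclusion of a subgroup `H` of `G`:
its component at `N` is `k[[H]] → k[H/(N ∩ H)] → k[G/N]`. -/
noncomputable def inclusion (H : Subgroup G) :
    CompletedGroupAlgebra k H →ₐ[k] CompletedGroupAlgebra k G :=
  AlgHom.codRestrict
    (AlgHom.pi (A := fun N : OpenNormalSubgroup G => MonoidAlgebra k (G ⧸ (N : Subgroup G)))
      fun N => (finiteLevelInclusion k H N).comp (proj k H (restrictOpenNormal H N)))
    (completedGroupSubalgebra k G) (by
      intro x N M h
      have hNM : restrictOpenNormal H N ≤ restrictOpenNormal H M := fun a ha => h ha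
      have hx : groupAlgebraTransition k H hNM (proj k H (restrictOpenNormal H N) x) =
          proj k H (restrictOpenNormal H M) x := x.2 _ _ hNM
      have hcomp : (groupAlgebraTransition k G h).comp (finiteLevelInclusion k H N) =
          (finiteLevelInclusion k H M).comp (groupAlgebraTransition k H hNM) := by
        unfold groupAlgebraTransition finiteLevelInclusion
        rw [← MonoidAlgebra.mapDomainAlgHom_comp, ← MonoidAlgebra.mapDomainAlgHom_comp]
        congr 1
        ext a
        rfl
      change groupAlgebraTransition k G h
          (finiteLevelInclusion k H N (proj k H (restrictOpenNormal H N) x)) =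
        finiteLevelInclusion k H M (proj k H (restrictOpenNormal H M) x)
      rw [← hx]
      exact DFunLike.congr_fun hcomp (proj k H (restrictOpenNormal H N) x))

end CompletedGroupAlgebra

end CompletedGroupAlgebraDefinition

/-- A profinite module over a topological ring `A`: a profinite additive abelian group `U` with a
jointly continuous action `A × U → U` satisfying the module axioms. -/
class IsProfiniteModule (A : Type*) [Ring A] [TopologicalSpace A] (U : Type*) [AddCommGroup U]
    [Module A U] [TopologicalSpace U] : Prop extends
    IsTopologicalAddGroup U, ContinuousSMul A U, CompactSpace U, T2Space U,
    TotallyDisconnectedSpace U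

/-- A profinite module is indecomposable if it is non-zero and not the direct sum of two non-zero
closed submodules. -/
def IsIndecomposableProfinite (A : Type*) [Ring A] (U : Type*) [AddCommGroup U]
    [Module A U] [TopologicalSpace U] : Prop :=
  Nontrivial U ∧ ∀ X Y : Submodule A U, IsClosed (X : Set U) → IsClosed (Y : Set U) →
    IsCompl X Y → X = ⊥ ∨ Y = ⊥

section Vertices

variable (k : Type u) [Field k] {G : Type v} [Group G] [TopologicalSpace G]

/-- `U` is relatively `H`-projective: for every continuous epimorphism `β : V → W` and every
continuous homomorphism `φ : U → W` of profinite `k[[G]]`-modules, if there is a continuous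
`k[[H]]`-homomorphism `ρ' : U → V` with `β ρ' = φ`, then there is a continuous
`k[[G]]`-homomorphism `ρ : U → V` with `β ρ = φ`. Here `k[[H]]` acts through `k[[H]] → k[[G]]`. -/
def IsRelativelyProjective (H : Subgroup G) (U : Type w) [AddCommGroup U]
    [Module (CompletedGroupAlgebra k G) U] [TopologicalSpace U] : Prop :=
  ∀ (V W : Type (max u v w))
    [AddCommGroup V] [Module (CompletedGroupAlgebra k G) V] [TopologicalSpace V]
    [IsProfiniteModule (CompletedGroupAlgebra k G) V]
    [AddCommGroup W] [Module (CompletedGroupAlgebra k G) W] [TopologicalSpace W]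
    [IsProfiniteModule (CompletedGroupAlgebra k G) W]
    (φ : U →L[CompletedGroupAlgebra k G] W) (β : V →L[CompletedGroupAlgebra k G] W),
    Function.Surjective β →
    (∃ ρ' : U →+ V, Continuous ρ' ∧
      (∀ (a : CompletedGroupAlgebra k H) (x : U),
        ρ' (CompletedGroupAlgebra.inclusion k H a • x) =
          CompletedGroupAlgebra.inclusion k H a • ρ' x) ∧
      ∀ x : U, β (ρ' x) = φ x) →
    ∃ ρ : U →L[CompletedGroupAlgebra k G] V, ∀ x : U, β (ρ x) = φ x

/-- `Q` is a vertex of `U`: a closed subgroup of `G` relative to which `U` is projective, such that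
`U` is not projective relative to any proper closed subgroup of `Q`. -/
def IsVertex (Q : Subgroup G) (U : Type w) [AddCommGroup U]
    [Module (CompletedGroupAlgebra k G) U] [TopologicalSpace U] : Prop :=
  IsClosed (Q : Set G) ∧ IsRelativelyProjective k Q U ∧
    ∀ Q' : Subgroup G, IsClosed (Q' : Set G) → Q' < Q → ¬ IsRelativelyProjective k Q' U

end Vertices

/-- A profinite group `P` is pro-`p` if `P/N` is a `p`-group for every open normal
subgroup `N` of `P`. -/
def IsProP (p : ℕ) (P : Type*) [Group P] [TopologicalSpace P] : Prop :=
  ∀ N : OpenNormalSubgroup P, IsPGroup p (P ⧸ (N : Subgroup P))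

/-!
The proof works with Higman's criterion, Mackey's argument and compactness.

*Vertices are pro-`p`.* Let `Q` be a vertex and `N` an open normal subgroup of `Q`. The preimage `P`
in `Q` of a Sylow `p`-subgroup of `Q/N` is closed and its index is invertible in `k`. Averaging
lifts over `Q/P` shows that `U` is relatively `P`-projective
(`IsRelativelyProjective.of_index_ne_zero`), so `P = Q` by minimality and `Q/N` is a `p`-group.

*Open subgroups.* If `H` is open and `U` is relatively `H`-projective, splitting the augmentation
`k[G/H] ⊗ U → U` writes the identity of `U` as the trace of an `H`-endomorphism
(`IsRelativelyProjective.exists_trace_family`). For two open subgroups `H`, `K`, the product of the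
two traces is a sum over `G/H × G/K`, which breaks up into one `G`-endomorphism for each `G`-orbit.
The endomorphism ring of `U` is local (`Module.End.exists_isUnit_of_isUnit_sum`): by the
Ellis–Numakura lemma the iterates of an endomorphism `f` accumulate at an idempotent, which is `0`
or `1` as `U` is indecomposable, and accordingly `1 - f` or `f` is bijective. Hence the endomorphism
of some orbit is invertible, and therefore `U` is projective relative to a point stabiliser
`H ∩ gKg⁻¹` of that orbit (`IsRelativelyProjective.exists_inf_conj`).

*Closed subgroups.* As `U` is finitely generated, relative projectivity for `HN` with `N` running
over the open normal subgroups implies it for `H` (`IsRelativelyProjective.of_forall_sup`). If `Q`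
and `R` are vertices, apply the open case to `QN` and `RN`; compactness of `G` provides one `x` that
works for all `N`, so `U` is projective relative to `Q ∩ xRx⁻¹`. Minimality of `Q` gives
`Q ≤ xRx⁻¹`, and minimality of `R`, applied to `x⁻¹Qx ≤ R`, gives equality.

Homomorphisms of modules over `k[[H]]` are handled as continuous `k`-linear maps that commute with
`H`, which is the same by density of `k[H]` in `k[[H]]`. The module structure on `k[G/H] ⊗ U` comes
from restricting elements of `k[[G]]`, viewed as measures on `G`, to clopen subsets
(`CompletedGroupAlgebra.exists_restriction`).
-/

open Topology

/-! ### The completed group algebra as a compact topological ring -/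

namespace CompletedGroupAlgebra

section Topology

variable (k : Type u) [Field k] {G : Type v} [Group G] [TopologicalSpace G]

variable {k} in
theorem ext_proj {a b : CompletedGroupAlgebra k G} (h : ∀ N, proj k G N a = proj k G N b) :
    a = b :=
  Subtype.ext (funext h)

variable {k} in
theorem transition_proj {N M : OpenNormalSubgroup G} (h : N ≤ M) (a : CompletedGroupAlgebra k G) :
    groupAlgebraTransition k G h (proj k G N a) = proj k G M a :=
  a.2 N M h

theorem groupAlgebraTransition_single {N M : OpenNormalSubgroup G} (h : N ≤ M) (g : G) (c : k) :
    groupAlgebraTransition k G h (MonoidAlgebra.single (g : G ⧸ (N : Subgroup G)) c) =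
      MonoidAlgebra.single (g : G ⧸ (M : Subgroup G)) c :=
  MonoidAlgebra.mapDomain_single

/-- The canonical map `G → k[[G]]`. -/
noncomputable def of : G →* CompletedGroupAlgebra k G where
  toFun g := ⟨fun N => MonoidAlgebra.of k _ (g : G ⧸ (N : Subgroup G)),
    fun _ _ h => groupAlgebraTransition_single k h g 1⟩
  map_one' := by
    refine ext_proj fun N => ?_
    rw [map_one]
    exact map_one (MonoidAlgebra.of k (G ⧸ (N : Subgroup G)))
  map_mul' g h := by
    refine ext_proj fun N => ?_
    exact map_mul (MonoidAlgebra.of k (G ⧸ (N : Subgroup G))) (g : G ⧸ (N : Subgroup G)) h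

theorem proj_of (N : OpenNormalSubgroup G) (g : G) :
    proj k G N (of k g) = MonoidAlgebra.of k _ (g : G ⧸ (N : Subgroup G)) :=
  rfl

variable {k}

theorem of_mul_of_inv (g : G) : of k g * of k g⁻¹ = 1 := by
  rw [← map_mul, mul_inv_cancel, map_one]

theorem of_inv_mul_of (g : G) : of k g⁻¹ * of k g = 1 := by
  rw [← map_mul, inv_mul_cancel, map_one]

instance : Nonempty (OpenNormalSubgroup G) :=
  ⟨{ toOpenSubgroup := ⊤, isNormal' := (inferInstance : (⊤ : Subgroup G).Normal) }⟩

theorem hasBasis_nhds (a : CompletedGroupAlgebra k G) :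
    (𝓝 a).HasBasis (fun _ : OpenNormalSubgroup G => True)
      fun N => {b | proj k G N b = proj k G N a} := by
  have h : 𝓝 a = ⨅ N : OpenNormalSubgroup G,
      Filter.principal {b | proj k G N b = proj k G N a} := by
    rw [nhds_iInf]
    refine iInf_congr fun N => ?_
    let : TopologicalSpace (MonoidAlgebra k (G ⧸ (N : Subgroup G))) := ⊥
    have : DiscreteTopology (MonoidAlgebra k (G ⧸ (N : Subgroup G))) := ⟨rfl⟩
    rw [nhds_induced, nhds_discrete, ← Filter.principal_singleton, Filter.comap_principal]
    rfl
  rw [h]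
  refine Filter.hasBasis_iInf_principal fun N M => ⟨N ⊓ M, ?_, ?_⟩
  · intro b hb
    have hb' : proj k G (N ⊓ M) b = proj k G (N ⊓ M) a := hb
    change proj k G N b = proj k G N a
    rw [← transition_proj inf_le_left, hb', transition_proj]
  · intro b hb
    have hb' : proj k G (N ⊓ M) b = proj k G (N ⊓ M) a := hb
    change proj k G M b = proj k G M a
    rw [← transition_proj inf_le_right, hb', transition_proj]

theorem continuous_iff {X : Type*} [TopologicalSpace X] {f : X → CompletedGroupAlgebra k G} :
    Continuous f ↔ ∀ (N : OpenNormalSubgroup G) (x : X),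
      ∀ᶠ y in 𝓝 x, proj k G N (f y) = proj k G N (f x) := by
  rw [continuous_iff_continuousAt, forall_comm]
  exact forall_congr' fun x => (hasBasis_nhds (f x)).tendsto_right_iff.trans (by simp)

theorem eventually_proj_eq (N : OpenNormalSubgroup G) (a : CompletedGroupAlgebra k G) :
    ∀ᶠ b in 𝓝 a, proj k G N b = proj k G N a :=
  continuous_iff.1 continuous_id N a

instance : IsTopologicalRing (CompletedGroupAlgebra k G) where
  continuous_add := continuous_iff.2 fun N x => by
    filter_upwards [(eventually_proj_eq N x.1).prod_nhds (eventually_proj_eq N x.2)] with y hy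
    rw [map_add, map_add, hy.1, hy.2]
  continuous_mul := continuous_iff.2 fun N x => by
    filter_upwards [(eventually_proj_eq N x.1).prod_nhds (eventually_proj_eq N x.2)] with y hy
    rw [map_mul, map_mul, hy.1, hy.2]
  continuous_neg := continuous_iff.2 fun N x => by
    filter_upwards [eventually_proj_eq N x] with y hy
    rw [map_neg, map_neg, hy]

/-- At every finite level an element of `k[[G]]` agrees with a linear combination of elements of
`G`, so a closed additive subgroup that contains the multiples of group elements is everything. -/
theorem mem_of_isClosed_of_smul_of_mem {S : AddSubgroup (CompletedGroupAlgebra k G)}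
    (hS : IsClosed (S : Set (CompletedGroupAlgebra k G)))
    (h : ∀ (c : k) (g : G), algebraMap k _ c * of k g ∈ S) (a : CompletedGroupAlgebra k G) :
    a ∈ S := by
  rw [← SetLike.mem_coe, ← hS.closure_eq, mem_closure_iff_nhds_basis (hasBasis_nhds a)]
  intro N _
  have key : ∀ x : MonoidAlgebra k (G ⧸ (N : Subgroup G)), ∃ b ∈ S, proj k G N b = x := by
    intro x
    induction x using MonoidAlgebra.induction_linear with
    | zero => exact ⟨0, S.zero_mem, map_zero _⟩
    | add x y hx hy =>
      obtain ⟨b, hb, rfl⟩ := hx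
      obtain ⟨c, hc, rfl⟩ := hy
      exact ⟨b + c, S.add_mem hb hc, map_add _ _ _⟩
    | single g c =>
      obtain ⟨g, rfl⟩ := QuotientGroup.mk_surjective g
      refine ⟨_, h c g, ?_⟩
      rw [map_mul, AlgHom.commutes, proj_of]
      simp
  obtain ⟨b, hb, hb'⟩ := key (proj k G N a)
  exact ⟨b, hb, hb'⟩

instance : T2Space (CompletedGroupAlgebra k G) := by
  refine t2Space_iff_disjoint_nhds.2 fun a b hab => ?_
  obtain ⟨N, hN⟩ : ∃ N, proj k G N a ≠ proj k G N b := by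
    by_contra! h
    exact hab (ext_proj h)
  refine ((hasBasis_nhds a).disjoint_iff (hasBasis_nhds b)).2 ⟨N, trivial, N, trivial, ?_⟩
  exact Set.disjoint_left.2 fun c hc hc' => hN (hc.symm.trans hc')

theorem addMonoidHom_ext {M : Type*} [AddCommGroup M] [TopologicalSpace M] [T2Space M]
    {f₁ f₂ : CompletedGroupAlgebra k G →+ M} (h₁ : Continuous f₁) (h₂ : Continuous f₂)
    (h : ∀ (c : k) (g : G), f₁ (algebraMap k _ c * of k g) = f₂ (algebraMap k _ c * of k g))
    (a : CompletedGroupAlgebra k G) : f₁ a = f₂ a :=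
  mem_of_isClosed_of_smul_of_mem (S := f₁.eqLocus f₂) (isClosed_eq h₁ h₂) h a

variable (k) in
theorem continuous_of [ContinuousMul G] : Continuous (of k : G → CompletedGroupAlgebra k G) :=
  continuous_iff.2 fun N x => by
    have : IsOpen {y : G | x⁻¹ * y ∈ N} := N.isOpen'.preimage (continuous_const_mul x⁻¹)
    filter_upwards [this.mem_nhds (by simp [one_mem])] with y hy
    rw [proj_of, proj_of, (QuotientGroup.eq.2 hy : (x : G ⧸ (N : Subgroup G)) = y)]

theorem continuous_inclusion (H : Subgroup G) : Continuous (inclusion k H) :=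
  continuous_iff.2 fun N x => by
    filter_upwards [eventually_proj_eq (restrictOpenNormal H N) x] with y hy
    change finiteLevelInclusion k H N (proj k H _ y) = finiteLevelInclusion k H N (proj k H _ x)
    rw [hy]

theorem inclusion_of (H : Subgroup G) (h : H) : inclusion k H (of k h) = of k (h : G) := by
  refine ext_proj fun N => ?_
  change finiteLevelInclusion k H N (proj k H _ (of k h)) = _
  exact MonoidAlgebra.mapDomain_single

instance [Finite k] [IsTopologicalGroup G] [CompactSpace G] :
    CompactSpace (CompletedGroupAlgebra k G) := by
  let (N : OpenNormalSubgroup G) : TopologicalSpace (MonoidAlgebra k (G ⧸ (N : Subgroup G))) := ⊥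
  have (N : OpenNormalSubgroup G) : DiscreteTopology (MonoidAlgebra k (G ⧸ (N : Subgroup G))) :=
    ⟨rfl⟩
  have (N : OpenNormalSubgroup G) : Finite (G ⧸ (N : Subgroup G)) :=
    Subgroup.quotient_finite_of_isOpen _ N.isOpen'
  have (N : OpenNormalSubgroup G) : Finite (MonoidAlgebra k (G ⧸ (N : Subgroup G))) :=
    Finite.of_injective (fun x => (x.coeff : G ⧸ (N : Subgroup G) → k)) fun x y h => by
      have := DFunLike.coe_injective h
      exact MonoidAlgebra.coeff_injective this
  let e : CompletedGroupAlgebra k G → ∀ N : OpenNormalSubgroup G,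
    MonoidAlgebra k (G ⧸ (N : Subgroup G)) := fun a N => proj k G N a
  have hind : IsInducing e := by
    refine ⟨?_⟩
    rw [Pi.topologicalSpace, induced_iInf]
    change (⨅ N : OpenNormalSubgroup G, TopologicalSpace.induced (proj k G N) ⊥) = _
    refine iInf_congr fun N => ?_
    rw [induced_compose]
    rfl
  refine IsClosedEmbedding.compactSpace (f := e)
    ⟨⟨hind, fun a b h => ext_proj fun N => congrFun h N⟩, ?_⟩
  have : Set.range e = ⋂ (N) (M) (h : N ≤ M), {x | groupAlgebraTransition k G h (x N) = x M} := by
    ext x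
    simp only [Set.mem_iInter, Set.mem_ofPred_eq]
    exact ⟨fun ⟨y, hy⟩ N M h => hy ▸ y.2 N M h, fun hx => ⟨⟨x, hx⟩, rfl⟩⟩
  rw [this]
  exact isClosed_iInter fun N => isClosed_iInter fun M => isClosed_iInter fun h =>
    isClosed_eq (continuous_of_discreteTopology.comp (continuous_apply N)) (continuous_apply M)

open Classical in
/-- Restriction of elements of `k[[G]]`, regarded as `k`-valued measures on `G`, to a clopen subset
`C` of `G` that is invariant under an open normal subgroup. -/
theorem exists_restriction (C : Set G) (N : OpenNormalSubgroup G)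
    (hC : ∀ g h : G, (g : G ⧸ (N : Subgroup G)) = h → (g ∈ C ↔ h ∈ C)) :
    ∃ r : CompletedGroupAlgebra k G →ₗ[k] CompletedGroupAlgebra k G, Continuous r ∧
      ∀ g : G, r (of k g) = if g ∈ C then of k g else 0 := by
  let D : ∀ M : OpenNormalSubgroup G, Set (G ⧸ ((M ⊓ N : OpenNormalSubgroup G) : Subgroup G)) :=
    fun M => {x | ∃ g ∈ C, (g : G ⧸ ((M ⊓ N : OpenNormalSubgroup G) : Subgroup G)) = x}
  have hD : ∀ M (g : G), (g : G ⧸ ((M ⊓ N : OpenNormalSubgroup G) : Subgroup G)) ∈ D M ↔ g ∈ C := by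
    refine fun M g => ⟨fun ⟨h, hh, hg⟩ => ?_, fun hg => ⟨g, hg, rfl⟩⟩
    refine (hC h g ?_).1 hh
    rw [QuotientGroup.eq] at hg ⊢
    exact hg.2
  let q : ∀ M : OpenNormalSubgroup G,
      G ⧸ ((M ⊓ N : OpenNormalSubgroup G) : Subgroup G) →* G ⧸ (M : Subgroup G) :=
    fun M => QuotientGroup.map _ _ (MonoidHom.id G) (inf_le_left : M ⊓ N ≤ M)
  let L : ∀ M : OpenNormalSubgroup G,
      MonoidAlgebra k (G ⧸ ((M ⊓ N : OpenNormalSubgroup G) : Subgroup G)) →ₗ[k]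
        MonoidAlgebra k (G ⧸ (M : Subgroup G)) := fun M =>
    (Finsupp.lsum k fun x => if x ∈ D M then
        LinearMap.toSpanSingleton k _ (MonoidAlgebra.of k _ (q M x)) else 0) ∘ₗ
      (MonoidAlgebra.coeffLinearEquiv k).toLinearMap
  have hL : ∀ M (g : G) (c : k), L M (MonoidAlgebra.single g c) =
      if g ∈ C then MonoidAlgebra.single (g : G ⧸ (M : Subgroup G)) c else 0 := by
    intro M g c
    by_cases hg : g ∈ C
    · simp [L, (hD M g).2 hg, hg, q]
      rfl
    · simp [L, hD, hg]
  have hcompat : ∀ M₁ M₂ (h : M₁ ≤ M₂) (x : CompletedGroupAlgebra k G),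
      groupAlgebraTransition k G h (L M₁ (proj k G (M₁ ⊓ N) x)) = L M₂ (proj k G (M₂ ⊓ N) x) := by
    intro M₁ M₂ h x
    have h' : M₁ ⊓ N ≤ M₂ ⊓ N := inf_le_inf_right N h
    rw [← transition_proj h' x]
    generalize proj k G (M₁ ⊓ N) x = y
    induction y using MonoidAlgebra.induction_linear with
    | zero => simp
    | add y z hy hz => simp only [map_add, hy, hz]
    | single g c =>
      obtain ⟨g, rfl⟩ := QuotientGroup.mk_surjective g
      rw [groupAlgebraTransition_single, hL, hL]
      by_cases hg : g ∈ C <;> simp only [hg, if_true, if_false, map_zero]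
      exact groupAlgebraTransition_single k h g c
  refine ⟨{ toFun := fun x => ⟨fun M => L M (proj k G (M ⊓ N) x), fun M₁ M₂ h =>
              hcompat M₁ M₂ h x⟩
            map_add' := fun x y => ext_proj fun M => ?_
            map_smul' := fun c x => ext_proj fun M => ?_ }, ?_, ?_⟩
  · change L M (proj k G (M ⊓ N) (x + y)) = L M (proj k G (M ⊓ N) x) + L M (proj k G (M ⊓ N) y)
    rw [map_add, map_add]
  · change L M (proj k G (M ⊓ N) (c • x)) = c • L M (proj k G (M ⊓ N) x)
    rw [map_smul, map_smul]
  · refine continuous_iff.2 fun M x => ?_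
    filter_upwards [eventually_proj_eq (M ⊓ N) x] with y hy
    change L M (proj k G (M ⊓ N) y) = L M (proj k G (M ⊓ N) x)
    rw [hy]
  · intro g
    refine ext_proj fun M => ?_
    change L M (MonoidAlgebra.single (g : G ⧸ _) 1) = _
    rw [hL]
    by_cases hg : g ∈ C <;> simp [hg, proj_of]

end Topology

end CompletedGroupAlgebra

/-! ### Equivariant maps, conjugation and sums over finite `G`-sets -/

section Equivariant

open CompletedGroupAlgebra

variable (k : Type u) [Field k] {G : Type v} [Group G] [TopologicalSpace G]
  {U V W : Type*}
  [AddCommGroup U] [Module (CompletedGroupAlgebra k G) U]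
  [AddCommGroup V] [Module (CompletedGroupAlgebra k G) V]
  [AddCommGroup W] [Module (CompletedGroupAlgebra k G) W]

/-- An additive map between `k[[G]]`-modules is `H`-equivariant if it commutes with the scalars
from `k` and with the elements of `H`. For `H = ⊥` this is `k`-linearity. -/
structure IsEquivariant (H : Subgroup G) (f : U →+ V) : Prop where
  map_scalar_smul (c : k) (u : U) :
    f (algebraMap k (CompletedGroupAlgebra k G) c • u) =
      algebraMap k (CompletedGroupAlgebra k G) c • f u
  map_of_smul (h : G) (hh : h ∈ H) (u : U) : f (of k h • u) = of k h • f u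

variable {k}

theorem IsEquivariant.mono {H K : Subgroup G} (hHK : H ≤ K) {f : U →+ V}
    (hf : IsEquivariant k K f) : IsEquivariant k H f :=
  ⟨hf.1, fun h hh => hf.2 h (hHK hh)⟩

theorem IsEquivariant.comp {H : Subgroup G} {f : V →+ W} {g : U →+ V}
    (hf : IsEquivariant k H f) (hg : IsEquivariant k H g) : IsEquivariant k H (f.comp g) :=
  ⟨fun c u => by simp [hg.1, hf.1], fun h hh u => by simp [hg.2 h hh, hf.2 h hh]⟩

theorem LinearMap.isEquivariant (H : Subgroup G) (f : U →ₗ[CompletedGroupAlgebra k G] V) :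
    IsEquivariant k H f.toAddMonoidHom :=
  ⟨fun _ u => f.map_smul _ u, fun _ _ u => f.map_smul _ u⟩

section Continuous

variable [TopologicalSpace U] [ContinuousSMul (CompletedGroupAlgebra k G) U]
  [TopologicalSpace V] [T2Space V] [ContinuousSMul (CompletedGroupAlgebra k G) V]

/-- A continuous `H`-equivariant map is a homomorphism of `k[[H]]`-modules, by density of `k[H]`. -/
theorem IsEquivariant.map_inclusion_smul {H : Subgroup G} {f : U →+ V}
    (hf : IsEquivariant k H f) (hc : Continuous f) (a : CompletedGroupAlgebra k H) (u : U) :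
    f (inclusion k H a • u) = inclusion k H a • f u := by
  let S : AddSubgroup (CompletedGroupAlgebra k H) :=
    { carrier := {a | f (inclusion k H a • u) = inclusion k H a • f u}
      zero_mem' := by simp
      add_mem' := fun {a b} ha hb => by
        simp only [Set.mem_ofPred_eq] at ha hb ⊢
        rw [map_add, add_smul, add_smul, map_add, ha, hb]
      neg_mem' := fun {a} ha => by
        simp only [Set.mem_ofPred_eq] at ha ⊢
        rw [map_neg, neg_smul, neg_smul, map_neg, ha] }
  refine mem_of_isClosed_of_smul_of_mem (S := S) ?_ (fun c h => ?_) a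
  · have := continuous_inclusion (k := k) H
    exact isClosed_eq (by fun_prop) (by fun_prop)
  · change f (inclusion k H _ • u) = inclusion k H _ • f u
    rw [map_mul, AlgHom.commutes, inclusion_of, mul_smul, mul_smul, hf.1, hf.2 h h.2]

/-- A continuous map that commutes with the scalars and with all of `G` is `k[[G]]`-linear. -/
theorem IsEquivariant.map_smul {f : U →+ V} (hf : IsEquivariant k (⊤ : Subgroup G) f)
    (hc : Continuous f)
    (a : CompletedGroupAlgebra k G) (u : U) : f (a • u) = a • f u := by
  let S : AddSubgroup (CompletedGroupAlgebra k G) :=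
    { carrier := {a | f (a • u) = a • f u}
      zero_mem' := by simp
      add_mem' := fun {a b} ha hb => by
        simp only [Set.mem_ofPred_eq] at ha hb ⊢
        rw [add_smul, add_smul, map_add, ha, hb]
      neg_mem' := fun {a} ha => by
        simp only [Set.mem_ofPred_eq] at ha ⊢
        rw [neg_smul, neg_smul, map_neg, ha] }
  refine mem_of_isClosed_of_smul_of_mem (S := S) ?_ (fun c h => ?_) a
  · exact isClosed_eq (by fun_prop) (by fun_prop)
  · change f (_ • u) = _ • f u
    rw [mul_smul, mul_smul, hf.1, hf.2 h trivial]

end Continuous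

theorem isEquivariant_of_map_inclusion_smul {H : Subgroup G} {f : U →+ V}
    (hf : ∀ (a : CompletedGroupAlgebra k H) (u : U),
      f (inclusion k H a • u) = inclusion k H a • f u) : IsEquivariant k H f where
  map_scalar_smul c u := by
    have := hf (algebraMap k _ c) u
    rwa [AlgHom.commutes] at this
  map_of_smul h hh u := by
    have := hf (of k ⟨h, hh⟩) u
    rwa [inclusion_of] at this

/-- The conjugate `g f g⁻¹` of an additive map `f`. -/
noncomputable def conjMap (g : G) (f : U →+ V) : U →+ V where
  toFun u := of k g • f (of k g⁻¹ • u)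
  map_zero' := by simp
  map_add' u v := by simp

theorem conjMap_apply (g : G) (f : U →+ V) (u : U) :
    conjMap (k := k) g f u = of k g • f (of k g⁻¹ • u) :=
  rfl

theorem conjMap_mul (g h : G) (f : U →+ V) :
    conjMap (k := k) (g * h) f = conjMap (k := k) g (conjMap (k := k) h f) := by
  ext u
  simp only [conjMap_apply, mul_inv_rev, map_mul, mul_smul]

theorem IsEquivariant.conjMap_eq {H : Subgroup G} {f : U →+ V} (hf : IsEquivariant k H f) {g : G}
    (hg : g ∈ H) : conjMap (k := k) g f = f := by
  ext u
  rw [conjMap_apply, ← hf.2 g hg, ← mul_smul, of_mul_of_inv, one_smul]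

theorem conjMap_comp (g : G) (f : V →+ W) (f' : U →+ V) :
    conjMap (k := k) g (f.comp f') = (conjMap (k := k) g f).comp (conjMap (k := k) g f') := by
  ext u
  simp only [conjMap_apply, AddMonoidHom.comp_apply]
  rw [← mul_smul (of k g⁻¹), of_inv_mul_of, one_smul]

theorem of_smul_apply_eq_conjMap (g : G) (f : U →+ V) (u : U) :
    of k g • f u = conjMap (k := k) g f (of k g • u) := by
  rw [conjMap_apply, ← mul_smul (of k g⁻¹), of_inv_mul_of, one_smul]

theorem IsEquivariant.conjMap {H : Subgroup G} {f : U →+ V} (hf : IsEquivariant k H f) (g : G) :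
    IsEquivariant k (H.map (MulAut.conj g).toMonoidHom) (conjMap (k := k) g f) where
  map_scalar_smul c u := by
    rw [conjMap_apply, conjMap_apply, ← mul_smul, ← Algebra.commutes, mul_smul, hf.1, ← mul_smul,
      ← Algebra.commutes, mul_smul]
  map_of_smul h hh u := by
    obtain ⟨x, hx, rfl⟩ := hh
    have : g⁻¹ * (g * x * g⁻¹) = x * g⁻¹ := by group
    simp only [MulEquiv.toMonoidHom_eq_coe, MonoidHom.coe_coe, MulAut.conj_apply, conjMap_apply]
    rw [← mul_smul (of k g⁻¹), ← map_mul, this, map_mul, mul_smul, hf.2 x hx]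
    simp only [← mul_smul, ← map_mul, inv_mul_cancel_right]

theorem IsEquivariant.conjMap_bot {H : Subgroup G} {f : U →+ V} (hf : IsEquivariant k H f)
    (g : G) : IsEquivariant k (⊥ : Subgroup G) (_root_.conjMap (k := k) g f) :=
  (hf.conjMap g).mono bot_le

/-- A conjugate of a lift of a `G`-homomorphism is again a lift. -/
theorem map_conjMap_of_lift {φ : U →ₗ[CompletedGroupAlgebra k G] W}
    {β : V →ₗ[CompletedGroupAlgebra k G] W}
    {f : U →+ V} (hlift : ∀ x, β (f x) = φ x) (g : G) (x : U) :
    β (conjMap (k := k) g f x) = φ x := by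
  rw [conjMap_apply, map_smul, hlift, map_smul, ← mul_smul, of_mul_of_inv, one_smul]

theorem continuous_conjMap [TopologicalSpace U] [ContinuousSMul (CompletedGroupAlgebra k G) U]
    [TopologicalSpace V] [ContinuousSMul (CompletedGroupAlgebra k G) V] (g : G) {f : U →+ V}
    (hf : Continuous f) : Continuous (conjMap (k := k) g f) :=
  (hf.comp (continuous_const_smul _)).const_smul _

/-- The sum of a family of `k`-linear maps indexed by a finite `S`-set and compatible with the
action of `S` commutes with the image of `S` in `G`. -/
theorem isEquivariant_sum {S : Type*} [Group S] (θ : S →* G) {X : Type*} [Fintype X]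
    [MulAction S X] {f : X → U →+ V} (hf : ∀ x, IsEquivariant k (⊥ : Subgroup G) (f x))
    (hconj : ∀ s x, f (s • x) = conjMap (k := k) (θ s) (f x)) :
    IsEquivariant k θ.range (∑ x, f x) where
  map_scalar_smul c u := by
    simp only [AddMonoidHom.finsetSum_apply, (hf _).1, Finset.smul_sum]
  map_of_smul h hh u := by
    obtain ⟨s, rfl⟩ := hh
    simp only [AddMonoidHom.finsetSum_apply, Finset.smul_sum]
    rw [← Equiv.sum_comp (MulAction.toPerm s)]
    refine Finset.sum_congr rfl fun x _ => ?_
    rw [MulAction.toPerm_apply, hconj, of_smul_apply_eq_conjMap]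

/-- A map that is equivariant for the point stabiliser of a transitive `S`-set spreads to a family
of conjugates indexed by that set. -/
theorem exists_conjugate_family {S : Type*} [Group S] (θ : S →* G) {X : Type*}
    [MulAction S X] [MulAction.IsPretransitive S X] (x₀ : X) {H : Subgroup G} {f : U →+ V}
    (hf : IsEquivariant k H f) (hH : ∀ s : S, s • x₀ = x₀ → θ s ∈ H) :
    ∃ F : X → U →+ V, (∀ x, ∃ g : G, F x = conjMap (k := k) g f) ∧
      (∀ s x, F (s • x) = conjMap (k := k) (θ s) (F x)) ∧ F x₀ = f := by
  choose t ht using MulAction.exists_smul_eq S x₀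
  refine ⟨fun x => conjMap (k := k) (θ (t x)) f, fun x => ⟨_, rfl⟩, fun s x => ?_, ?_⟩
  · have h1 : ((t (s • x))⁻¹ * (s * t x)) • x₀ = x₀ := by
      rw [mul_smul, inv_smul_eq_iff, mul_smul, ht, ht]
    have h2 : θ s * θ (t x) = θ (t (s • x)) * θ ((t (s • x))⁻¹ * (s * t x)) := by
      rw [← map_mul, ← map_mul, mul_inv_cancel_left]
    rw [← conjMap_mul, h2, conjMap_mul, hf.conjMap_eq (hH _ h1)]
  · exact hf.conjMap_eq (hH _ (ht x₀))

end Equivariant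

/-! ### Relative projectivity -/

section RelativeProjectivity

open CompletedGroupAlgebra

variable {k : Type u} [Field k] {G : Type v} [Group G] [TopologicalSpace G]
  {U : Type w} [AddCommGroup U] [Module (CompletedGroupAlgebra k G) U] [TopologicalSpace U]
  [IsProfiniteModule (CompletedGroupAlgebra k G) U]

/-- The lifting property that defines relative projectivity, for `H`-equivariant maps instead of
homomorphisms of `k[[H]]`-modules. -/
theorem IsRelativelyProjective.exists_lift {H : Subgroup G}
    (hU : IsRelativelyProjective k H U) {V W : Type (max u v w)}
    [AddCommGroup V] [Module (CompletedGroupAlgebra k G) V] [TopologicalSpace V]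
    [IsProfiniteModule (CompletedGroupAlgebra k G) V]
    [AddCommGroup W] [Module (CompletedGroupAlgebra k G) W] [TopologicalSpace W]
    [IsProfiniteModule (CompletedGroupAlgebra k G) W]
    {φ : U →L[CompletedGroupAlgebra k G] W} {β : V →L[CompletedGroupAlgebra k G] W}
    (hβ : Function.Surjective β) (f : U →+ V) (hc : Continuous f) (hf : IsEquivariant k H f)
    (hlift : ∀ x, β (f x) = φ x) :
    ∃ ρ : U →L[CompletedGroupAlgebra k G] V, ∀ x, β (ρ x) = φ x :=
  hU V W φ β hβ ⟨f, hc, hf.map_inclusion_smul hc, hlift⟩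

/-- A relatively `K`-projective module is relatively `H`-projective if every `H`-equivariant lift
of a `G`-homomorphism can be replaced by a `K`-equivariant one. -/
theorem IsRelativelyProjective.of_exists_lift {H K : Subgroup G}
    (hU : IsRelativelyProjective k K U)
    (h : ∀ {V W : Type (max u v w)}
      [AddCommGroup V] [Module (CompletedGroupAlgebra k G) V] [TopologicalSpace V]
      [IsProfiniteModule (CompletedGroupAlgebra k G) V]
      [AddCommGroup W] [Module (CompletedGroupAlgebra k G) W] [TopologicalSpace W]
      [IsProfiniteModule (CompletedGroupAlgebra k G) W]
      (φ : U →L[CompletedGroupAlgebra k G] W) (β : V →L[CompletedGroupAlgebra k G] W)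
      (f : U →+ V), Continuous f → IsEquivariant k H f → (∀ x, β (f x) = φ x) →
      ∃ f' : U →+ V, Continuous f' ∧ IsEquivariant k K f' ∧ ∀ x, β (f' x) = φ x) :
    IsRelativelyProjective k H U := by
  intro V W _ _ _ _ _ _ _ _ φ β hβ ⟨ρ', hc, he, hl⟩
  obtain ⟨f', hc', hf', hl'⟩ := h φ β ρ' hc (isEquivariant_of_map_inclusion_smul he) hl
  exact hU.exists_lift hβ f' hc' hf' hl'

theorem IsRelativelyProjective.mono {H K : Subgroup G} (hU : IsRelativelyProjective k H U)
    (hHK : H ≤ K) : IsRelativelyProjective k K U :=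
  hU.of_exists_lift fun _ _ f hc hf hl => ⟨f, hc, hf.mono hHK, hl⟩

theorem IsRelativelyProjective.conj {H : Subgroup G} (hU : IsRelativelyProjective k H U) (g : G) :
    IsRelativelyProjective k (H.map (MulAut.conj g).toMonoidHom) U :=
  hU.of_exists_lift fun φ β f hc hf hl =>
    ⟨conjMap (k := k) g⁻¹ f, continuous_conjMap _ hc, by
      have := hf.conjMap g⁻¹
      rw [Subgroup.map_map] at this
      convert! this
      ext x
      simp [mul_assoc], map_conjMap_of_lift (φ := φ.toLinearMap) (β := β.toLinearMap) hl _⟩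

/-- Averaging lifts over the cosets: relative projectivity passes to subgroups whose index is
finite and invertible in `k`. -/
theorem IsRelativelyProjective.of_index_ne_zero {Q : Subgroup G} (P : Subgroup Q)
    (hU : IsRelativelyProjective k Q U) (hP : (P.index : k) ≠ 0) :
    IsRelativelyProjective k (P.map Q.subtype) U := by
  have hfin : P.FiniteIndex := ⟨fun h => hP (by rw [h, Nat.cast_zero])⟩
  let : Fintype (Q ⧸ P) := Fintype.ofFinite _
  refine hU.of_exists_lift fun φ β f hc hf hl => ?_
  obtain ⟨F, hF, hconj, -⟩ := exists_conjugate_family Q.subtype ((1 : Q) : Q ⧸ P) hf fun s hs => by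
    refine ⟨s, ?_, rfl⟩
    have : ((s * 1 : Q) : Q ⧸ P) = (1 : Q) := hs
    rw [mul_one, eq_comm, QuotientGroup.eq] at this
    simpa using this
  have hFe : ∀ x, IsEquivariant k (⊥ : Subgroup G) (F x) := fun x => by
    obtain ⟨g, hg⟩ := hF x
    exact hg ▸ hf.conjMap_bot g
  have hFc : ∀ x, Continuous (F x) := fun x => by
    obtain ⟨g, hg⟩ := hF x
    exact hg ▸ continuous_conjMap g hc
  have hFl : ∀ x u, β (F x u) = φ u := fun x u => by
    obtain ⟨g, hg⟩ := hF x
    exact hg ▸ map_conjMap_of_lift (φ := φ.toLinearMap) (β := β.toLinearMap) hl g u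
  have hsum := isEquivariant_sum Q.subtype hFe hconj
  rw [Subgroup.range_subtype] at hsum
  let c : CompletedGroupAlgebra k G := algebraMap k _ (P.index : k)⁻¹
  have hcomm : ∀ a : CompletedGroupAlgebra k G, a * c = c * a := fun a =>
    (Algebra.commutes _ a).symm
  refine ⟨(DistribSMul.toAddMonoidHom _ c).comp (∑ x, F x), ?_, ⟨?_, ?_⟩, ?_⟩
  · have : Continuous fun u => c • ∑ x, F x u :=
      (continuous_finsetSum _ fun x _ => hFc x).const_smul c
    convert this using 2 with u
    simp [Finset.smul_sum]
  · intro a u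
    simp only [AddMonoidHom.comp_apply, hsum.1, DistribSMul.toAddMonoidHom_apply, ← mul_smul, hcomm]
  · intro a ha u
    simp only [AddMonoidHom.comp_apply, hsum.2 a ha, DistribSMul.toAddMonoidHom_apply, ← mul_smul,
      hcomm]
  · intro u
    simp only [AddMonoidHom.comp_apply, DistribSMul.toAddMonoidHom_apply,
      AddMonoidHom.finsetSum_apply, map_smul, map_sum, hFl, Finset.sum_const, Finset.card_univ]
    rw [← Nat.card_eq_fintype_card, ← Subgroup.index, ← Nat.cast_smul_eq_nsmul
      (CompletedGroupAlgebra k G), ← mul_smul, ← map_natCast (algebraMap k _), ← map_mul,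
      mul_inv_cancel₀ hP, map_one, one_smul]

/-- A vertex is pro-`p`: the preimage in `Q` of a Sylow subgroup of a finite quotient has index
prime to `p`, so by minimality of `Q` it is all of `Q`. -/
theorem IsVertex.isProP (p : ℕ) [Fact p.Prime] [CharP k p] [IsTopologicalGroup G] [CompactSpace G]
    {Q : Subgroup G} (hQ : IsVertex k Q U) : IsProP p Q := by
  intro N
  obtain ⟨hcl, hproj, hmin⟩ := hQ
  have : CompactSpace Q := isCompact_iff_compactSpace.1 hcl.isCompact
  have : Finite (Q ⧸ (N : Subgroup Q)) := Subgroup.quotient_finite_of_isOpen _ N.isOpen'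
  obtain ⟨S⟩ : Nonempty (Sylow p (Q ⧸ (N : Subgroup Q))) := inferInstance
  let P : Subgroup Q := (S : Subgroup (Q ⧸ (N : Subgroup Q))).comap (QuotientGroup.mk' _)
  have hindex : P.index = (S : Subgroup (Q ⧸ (N : Subgroup Q))).index :=
    Subgroup.index_comap_of_surjective _ (QuotientGroup.mk'_surjective _)
  have hP : (P.index : k) ≠ 0 := by
    rw [hindex, Ne, CharP.cast_eq_zero_iff k p]
    exact S.not_dvd_index
  have hPopen : IsOpen (P : Set Q) := by
    refine Subgroup.isOpen_mono (H₁ := (N : Subgroup Q)) (fun x hx => ?_) N.isOpen'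
    change (x : Q ⧸ (N : Subgroup Q)) ∈ (S : Subgroup (Q ⧸ (N : Subgroup Q)))
    rw [(QuotientGroup.eq_one_iff x).2 hx]
    exact one_mem _
  have hPQ : P.map Q.subtype = Q := by
    by_contra hne
    refine hmin _ ?_ (lt_of_le_of_ne (Subgroup.map_subtype_le P) hne)
      (hproj.of_index_ne_zero P hP)
    have : IsClosed (Subtype.val '' (P : Set Q)) :=
      hcl.isClosedEmbedding_subtypeVal.isClosedMap _ (P.isClosed_of_isOpen hPopen)
    exact this
  have htop : (S : Subgroup (Q ⧸ (N : Subgroup Q))) = ⊤ := by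
    rw [eq_top_iff]
    rintro x -
    obtain ⟨y, rfl⟩ := QuotientGroup.mk_surjective x
    have hy : (y : G) ∈ P.map Q.subtype := hPQ.symm ▸ y.2
    obtain ⟨z, hz, hzy⟩ := hy
    rw [← Subtype.ext hzy]
    exact hz
  have := S.isPGroup'
  rw [htop] at this
  exact this.of_equiv Subgroup.topEquiv

end RelativeProjectivity

/-! ### Permutation modules and Higman's criterion -/

section PermutationModule

open CompletedGroupAlgebra

variable (k : Type u) [Field k] {G : Type v} [Group G] [TopologicalSpace G]
  {X : Type*} [MulAction G X] {N : OpenNormalSubgroup G}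

open Classical in
theorem exists_restriction_transporter (hN : ∀ n ∈ N, ∀ x : X, n • x = x) (x y : X) :
    ∃ r : CompletedGroupAlgebra k G →ₗ[k] CompletedGroupAlgebra k G, Continuous r ∧
      ∀ g : G, r (of k g) = if g • y = x then of k g else 0 := by
  refine exists_restriction {g : G | g • y = x} N fun g h hgh => ?_
  have : h • y = g • y := by
    rw [← mul_inv_cancel_left g h, mul_smul, hN _ (QuotientGroup.eq.1 hgh)]
  simp only [Set.mem_ofPred_eq, this]

/-- For a `G`-set `X` on which an open normal subgroup acts trivially, the restriction of elements
of `k[[G]]` to the clopen set of those `g` with `g • y = x`. -/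
noncomputable def transporterRestriction (hN : ∀ n ∈ N, ∀ x : X, n • x = x) (x y : X) :
    CompletedGroupAlgebra k G →ₗ[k] CompletedGroupAlgebra k G :=
  (exists_restriction_transporter k hN x y).choose

variable (hN : ∀ n ∈ N, ∀ x : X, n • x = x)

theorem continuous_transporterRestriction (x y : X) :
    Continuous (transporterRestriction k hN x y) :=
  (exists_restriction_transporter k hN x y).choose_spec.1

open Classical in
theorem transporterRestriction_of (x y : X) (g : G) :
    transporterRestriction k hN x y (of k g) = if g • y = x then of k g else 0 :=
  (exists_restriction_transporter k hN x y).choose_spec.2 g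

open Classical in
theorem transporterRestriction_smul_of (x y : X) (c : k) (g : G) :
    transporterRestriction k hN x y (algebraMap k _ c * of k g) =
      if g • y = x then algebraMap k _ c * of k g else 0 := by
  rw [← Algebra.smul_def, map_smul, transporterRestriction_of, smul_ite, smul_zero]

variable [Fintype X]

theorem sum_transporterRestriction (y : X) (a : CompletedGroupAlgebra k G) :
    ∑ x, transporterRestriction k hN x y a = a := by
  classical
  have := addMonoidHom_ext (f₁ := ∑ x, (transporterRestriction k hN x y).toAddMonoidHom)
    (f₂ := AddMonoidHom.id _) ?_ continuous_id ?_ a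
  · simpa using this
  · have : Continuous fun a => ∑ x, transporterRestriction k hN x y a :=
      continuous_finsetSum _ fun x _ => continuous_transporterRestriction k hN x y
    convert this using 2 with a
    simp
  · intro c g
    simp [transporterRestriction_smul_of]

/-- The restrictions to transporters multiply like the entries of matrices. -/
theorem transporterRestriction_mul (x z : X) (a b : CompletedGroupAlgebra k G) :
    transporterRestriction k hN x z (a * b) =
      ∑ y, transporterRestriction k hN x y a * transporterRestriction k hN y z b := by
  classical
  have hcont := continuous_transporterRestriction k hN
  have := addMonoidHom_ext
    (f₁ := (transporterRestriction k hN x z).toAddMonoidHom.comp (AddMonoidHom.mulRight b))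
    (f₂ := ∑ y, (AddMonoidHom.mulRight (transporterRestriction k hN y z b)).comp
      (transporterRestriction k hN x y).toAddMonoidHom) ?_ ?_ ?_ a
  · simpa using this
  · exact (hcont x z).comp (continuous_mul_const b)
  · have : Continuous fun a => ∑ y, transporterRestriction k hN x y a *
        transporterRestriction k hN y z b :=
      continuous_finsetSum _ fun y _ => (hcont x y).mul_const _
    convert this using 2 with a
    simp
  intro c g
  have := addMonoidHom_ext
    (f₁ := (transporterRestriction k hN x z).toAddMonoidHom.comp
      (AddMonoidHom.mulLeft (algebraMap k _ c * of k g)))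
    (f₂ := ∑ y, (AddMonoidHom.mulLeft (transporterRestriction k hN x y
      (algebraMap k _ c * of k g))).comp
      (transporterRestriction k hN y z).toAddMonoidHom) ?_ ?_ ?_ b
  · simpa using this
  · exact (hcont x z).comp (continuous_const_mul _)
  · have : Continuous fun b => ∑ y, transporterRestriction k hN x y (algebraMap k _ c * of k g) *
        transporterRestriction k hN y z b :=
      continuous_finsetSum _ fun y _ => (hcont y z).const_mul _
    convert this using 2 with a
    simp
  intro d h
  have hmul : (algebraMap k (CompletedGroupAlgebra k G) c * of k g) * (algebraMap k _ d * of k h) =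
      algebraMap k _ (c * d) * of k (g * h) := by
    rw [map_mul, map_mul, mul_assoc, mul_assoc, ← mul_assoc (of k g), ← Algebra.commutes d (of k g),
      mul_assoc]
  simp only [AddMonoidHom.comp_apply, AddMonoidHom.finsetSum_apply, AddMonoidHom.coe_mulLeft,
    LinearMap.toAddMonoidHom_coe, hmul, transporterRestriction_smul_of]
  rw [Finset.sum_eq_single (h • z)]
  · simp only [mul_smul, if_true]
    split_ifs
    · exact hmul.symm
    · rw [zero_mul]
  · intro y _ hy
    rw [if_neg (Ne.symm hy), mul_zero]
  · simp

/-- The module `k[X] ⊗ W` with diagonal action, for a finite `G`-set `X` on which the open normal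
subgroup `N` acts trivially. It is encoded as the group of functions `X → W`. -/
def PermutationModule (_ : ∀ n ∈ N, ∀ x : X, n • x = x) (W : Type*) := X → W

namespace PermutationModule

variable {W : Type*} [AddCommGroup W] [Module (CompletedGroupAlgebra k G) W]

instance : AddCommGroup (PermutationModule hN W) := inferInstanceAs (AddCommGroup (X → W))

noncomputable instance : SMul (CompletedGroupAlgebra k G) (PermutationModule hN W) where
  smul a f := fun x => ∑ y, transporterRestriction k hN x y a • f y

variable {k} in
theorem smul_apply (a : CompletedGroupAlgebra k G) (f : PermutationModule hN W) (x : X) :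
    (a • f) x = ∑ y, transporterRestriction k hN x y a • f y :=
  rfl

variable {k} in
theorem scalar_mul_of_smul_apply (c : k) (g : G) (f : PermutationModule hN W) (x : X) :
    ((algebraMap k (CompletedGroupAlgebra k G) c * of k g) • f) x =
      (algebraMap k (CompletedGroupAlgebra k G) c * of k g) • f (g⁻¹ • x) := by
  classical
  rw [smul_apply, Finset.sum_eq_single (g⁻¹ • x)]
  · rw [transporterRestriction_smul_of, if_pos (smul_inv_smul g x)]
  · intro y _ hy
    rw [transporterRestriction_smul_of, if_neg, zero_smul]
    rintro rfl
    exact hy (inv_smul_smul g y).symm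
  · simp

theorem of_smul_apply (g : G) (f : PermutationModule hN W) (x : X) :
    (of k g • f) x = of k g • f (g⁻¹ • x) := by
  simpa using scalar_mul_of_smul_apply hN (1 : k) g f x

theorem scalar_smul_apply (c : k) (f : PermutationModule hN W) (x : X) :
    (algebraMap k (CompletedGroupAlgebra k G) c • f) x =
      algebraMap k (CompletedGroupAlgebra k G) c • f x := by
  simpa using scalar_mul_of_smul_apply hN c 1 f x

noncomputable instance : Module (CompletedGroupAlgebra k G) (PermutationModule hN W) :=
  Module.ofMinimalAxioms
    (fun a f g => by
      funext x
      change ∑ y, _ • (f y + g y) = ∑ y, _ • f y + ∑ y, _ • g y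
      simp only [smul_add, Finset.sum_add_distrib])
    (fun a b f => by
      funext x
      change ∑ y, transporterRestriction k hN x y (a + b) • f y = ∑ y, _ • f y + ∑ y, _ • f y
      simp only [map_add, add_smul, Finset.sum_add_distrib])
    (fun a b f => by
      funext x
      simp only [smul_apply, transporterRestriction_mul, Finset.smul_sum, Finset.sum_smul]
      rw [Finset.sum_comm]
      simp only [mul_smul])
    (fun f => by
      funext x
      have := of_smul_apply k hN 1 f x
      simpa using this)

variable [TopologicalSpace W]

instance : TopologicalSpace (PermutationModule hN W) :=
  inferInstanceAs (TopologicalSpace (X → W))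

instance [IsProfiniteModule (CompletedGroupAlgebra k G) W] :
    IsProfiniteModule (CompletedGroupAlgebra k G) (PermutationModule hN W) where
  toIsTopologicalAddGroup :=
    haveI : IsTopologicalAddGroup W :=
      IsProfiniteModule.toIsTopologicalAddGroup (CompletedGroupAlgebra k G)
    inferInstanceAs (IsTopologicalAddGroup (X → W))
  continuous_smul := by
    have : IsTopologicalAddGroup W :=
      IsProfiniteModule.toIsTopologicalAddGroup (CompletedGroupAlgebra k G)
    refine continuous_pi fun x => ?_
    refine continuous_finsetSum _ fun y _ => ?_
    exact ((continuous_transporterRestriction k hN x y).comp continuous_fst).smul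
      ((continuous_apply y).comp continuous_snd)
  toCompactSpace :=
    haveI : CompactSpace W := IsProfiniteModule.toCompactSpace (CompletedGroupAlgebra k G)
    inferInstanceAs (CompactSpace (X → W))
  toT2Space :=
    haveI : T2Space W := IsProfiniteModule.toT2Space (CompletedGroupAlgebra k G)
    inferInstanceAs (T2Space (X → W))
  toTotallyDisconnectedSpace :=
    haveI : TotallyDisconnectedSpace W :=
      IsProfiniteModule.toTotallyDisconnectedSpace (CompletedGroupAlgebra k G)
    inferInstanceAs (TotallyDisconnectedSpace (X → W))

/-- The augmentation `k[X] ⊗ W → W`, that is, summation over `X`. -/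
noncomputable def augmentation [IsProfiniteModule (CompletedGroupAlgebra k G) W] :
    PermutationModule hN W →L[CompletedGroupAlgebra k G] W where
  toFun f := ∑ x, f x
  map_add' f g := Finset.sum_add_distrib
  map_smul' a f := by
    let f' : X → W := f
    change ∑ x, ∑ y, transporterRestriction k hN x y a • f' y = a • ∑ x, f' x
    rw [Finset.sum_comm, Finset.smul_sum]
    refine Finset.sum_congr rfl fun y _ => ?_
    rw [← Finset.sum_smul, sum_transporterRestriction]
  cont := by
    have : IsTopologicalAddGroup W :=
      IsProfiniteModule.toIsTopologicalAddGroup (CompletedGroupAlgebra k G)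
    exact continuous_finsetSum _ fun x _ => continuous_apply x

end PermutationModule

end PermutationModule

section Higman

open CompletedGroupAlgebra

variable {k : Type u} [Field k] {G : Type v} [Group G] [TopologicalSpace G]
  {U : Type w} [AddCommGroup U] [Module (CompletedGroupAlgebra k G) U] [TopologicalSpace U]
  [IsProfiniteModule (CompletedGroupAlgebra k G) U]

instance : IsProfiniteModule (CompletedGroupAlgebra k G) (ULift.{max u v w} U) where
  continuous_add := by
    have : IsTopologicalAddGroup U :=
      IsProfiniteModule.toIsTopologicalAddGroup (CompletedGroupAlgebra k G)
    exact continuous_uliftUp.comp ((continuous_uliftDown.comp continuous_fst).add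
      (continuous_uliftDown.comp continuous_snd))
  continuous_neg := by
    have : IsTopologicalAddGroup U :=
      IsProfiniteModule.toIsTopologicalAddGroup (CompletedGroupAlgebra k G)
    exact continuous_uliftUp.comp continuous_uliftDown.neg
  continuous_smul := continuous_uliftUp.comp
    (continuous_fst.smul (continuous_uliftDown.comp continuous_snd))
  toCompactSpace :=
    haveI : CompactSpace U := IsProfiniteModule.toCompactSpace (CompletedGroupAlgebra k G)
    Homeomorph.ulift.symm.compactSpace
  toT2Space :=
    haveI : T2Space U := IsProfiniteModule.toT2Space (CompletedGroupAlgebra k G)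
    inferInstance
  toTotallyDisconnectedSpace :=
    haveI : TotallyDisconnectedSpace U :=
      IsProfiniteModule.toTotallyDisconnectedSpace (CompletedGroupAlgebra k G)
    Homeomorph.ulift.symm.totallyDisconnectedSpace

/-- One half of Higman's criterion: if `H` is open and `U` is relatively `H`-projective, then the
identity of `U` is a relative trace, i.e. a sum of conjugates `γ_x` of an `H`-equivariant
endomorphism, where `x` runs over `G/H`. It is obtained by splitting `k[G/H] ⊗ U → U`. -/
theorem IsRelativelyProjective.exists_trace_family [IsTopologicalGroup G] [CompactSpace G]
    {H : Subgroup G} (hH : IsOpen (H : Set G)) [Fintype (G ⧸ H)]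
    (hU : IsRelativelyProjective k H U) :
    ∃ γ : G ⧸ H → U →+ U, (∀ x, Continuous (γ x)) ∧
      (∀ x, IsEquivariant k (⊥ : Subgroup G) (γ x)) ∧
      (∀ (g : G) x, γ (g • x) = conjMap (k := k) g (γ x)) ∧ ∑ x, γ x = AddMonoidHom.id U := by
  classical
  obtain ⟨N, hNH⟩ := IsTopologicalGroup.exist_openNormalSubgroup_sub_clopen_nhds_of_one
    ⟨H.isClosed_of_isOpen hH, hH⟩ H.one_mem
  have hN : ∀ n ∈ N, ∀ x : G ⧸ H, n • x = x := by
    intro n hn x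
    obtain ⟨g, rfl⟩ := QuotientGroup.mk_surjective x
    refine (QuotientGroup.eq.2 (hNH ?_)).symm
    change g⁻¹ * (n * g) ∈ (N : Subgroup G)
    have := N.isNormal'.conj_mem n hn g⁻¹
    simpa [mul_assoc] using this
  let e : U ≃L[CompletedGroupAlgebra k G] ULift.{max u v w} U := ContinuousLinearEquiv.ulift.symm
  let β := PermutationModule.augmentation k hN (W := ULift.{max u v w} U)
  let f : U →+ PermutationModule hN (ULift.{max u v w} U) :=
    (AddMonoidHom.single (fun _ : G ⧸ H => ULift.{max u v w} U) ((1 : G) : G ⧸ H)).comp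
      e.toLinearEquiv.toLinearMap.toAddMonoidHom
  have hf1 : ∀ u, f u ((1 : G) : G ⧸ H) = e u := fun u => Pi.single_eq_same _ _
  have hf2 : ∀ u x, x ≠ ((1 : G) : G ⧸ H) → f u x = 0 := fun u x hx => Pi.single_eq_of_ne hx _
  have hsurj : Function.Surjective β := by
    intro w
    refine ⟨f (e.symm w), ?_⟩
    change ∑ x, f (e.symm w) x = w
    rw [Finset.sum_eq_single ((1 : G) : G ⧸ H) (fun x _ hx => hf2 _ x hx) (by simp), hf1]
    exact e.apply_symm_apply w
  have hfc : Continuous f := continuous_pi fun x =>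
    (continuous_apply x).comp
      ((continuous_single (A := fun _ : G ⧸ H => ULift.{max u v w} U) _).comp e.continuous)
  have hfs (c : k) (u : U) : f (algebraMap k (CompletedGroupAlgebra k G) c • u) =
      algebraMap k (CompletedGroupAlgebra k G) c • f u := by
    funext x
    rw [PermutationModule.scalar_smul_apply]
    by_cases hx : x = ((1 : G) : G ⧸ H)
    · rw [hx, hf1, hf1, map_smul]
    · rw [hf2 _ x hx, hf2 _ x hx, smul_zero]
  have hfh (h : G) (hh : h ∈ H) (u : U) : f (of k h • u) = of k h • f u := by
    funext x
    rw [PermutationModule.of_smul_apply]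
    have h1 : h⁻¹ • x = ((1 : G) : G ⧸ H) ↔ x = ((1 : G) : G ⧸ H) := by
      rw [inv_smul_eq_iff]
      have : h • ((1 : G) : G ⧸ H) = ((1 : G) : G ⧸ H) := by
        refine (QuotientGroup.eq.2 ?_).symm
        simpa using hh
      rw [this]
    by_cases hx : x = ((1 : G) : G ⧸ H)
    · rw [h1.2 hx, hx, hf1, hf1, map_smul]
    · rw [hf2 _ x hx, hf2 _ _ (fun h' => hx (h1.1 h')), smul_zero]
  have hfl (u : U) : β (f u) = e u := by
    change ∑ x, f u x = e u
    rw [Finset.sum_eq_single ((1 : G) : G ⧸ H) (fun x _ hx => hf2 _ x hx) (by simp), hf1]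
  obtain ⟨ρ, hρ⟩ := hU.exists_lift (φ := (e : U →L[CompletedGroupAlgebra k G] _)) hsurj f hfc
    ⟨hfs, hfh⟩ hfl
  -- `γ_x` is the `x`-component of the splitting `ρ`.
  refine ⟨fun x => e.symm.toLinearEquiv.toLinearMap.toAddMonoidHom.comp
    ((Pi.evalAddMonoidHom (fun _ : G ⧸ H => ULift.{max u v w} U) x).comp
      ρ.toLinearMap.toAddMonoidHom), fun x => ?_, fun x => ⟨fun c u => ?_, fun g hg u => ?_⟩,
      fun g x => ?_, ?_⟩
  · exact e.symm.continuous.comp ((continuous_apply x).comp ρ.continuous)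
  · change e.symm (ρ (algebraMap k _ c • u) x) = algebraMap k _ c • e.symm (ρ u x)
    rw [map_smul, PermutationModule.scalar_smul_apply, map_smul]
  · rw [Subgroup.mem_bot.1 hg, map_one, one_smul, one_smul]
  · ext u
    change e.symm (ρ u (g • x)) = of k g • e.symm (ρ (of k g⁻¹ • u) x)
    rw [map_smul, PermutationModule.of_smul_apply, inv_inv, map_smul, ← mul_smul, of_mul_of_inv,
      one_smul]
  · ext u
    rw [AddMonoidHom.finsetSum_apply]
    let v : G ⧸ H → ULift.{max u v w} U := ρ u
    have hv : ∑ x, v x = e u := hρ u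
    change ∑ x, e.symm (v x) = u
    rw [← map_sum, hv, e.symm_apply_apply]

end Higman

/-! ### Endomorphisms of finitely generated indecomposable profinite modules -/

section Fitting

variable {A : Type*} [Ring A] [TopologicalSpace A] [CompactSpace A]
  {U : Type*} [AddCommGroup U] [Module A U] [TopologicalSpace U] [IsProfiniteModule A U]

/-- Homomorphisms out of a finitely generated profinite module are automatically continuous, because
such a module carries the quotient topology from a free module. -/
theorem LinearMap.continuous_of_finite_of_isProfiniteModule [Module.Finite A U]
    {V : Type*} [AddCommGroup V] [Module A V] [TopologicalSpace V] [ContinuousAdd V]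
    [ContinuousSMul A V] (f : U →ₗ[A] V) : Continuous f := by
  have : T2Space U := IsProfiniteModule.toT2Space A
  have : IsTopologicalAddGroup U := IsProfiniteModule.toIsTopologicalAddGroup A
  obtain ⟨n, π, hπ⟩ := Module.Finite.exists_fin' A U
  have hc : Continuous π := LinearMap.continuous_on_pi π
  rw [(hc.isClosedMap.isQuotientMap hc hπ).continuous_iff]
  exact LinearMap.continuous_on_pi (f ∘ₗ π)

omit [CompactSpace A] in
/-- Among the pointwise limits of the iterates of `f` there is an idempotent endomorphism, by the
Ellis–Numakura lemma. -/
theorem exists_isIdempotentElem_mem_closure_iterate (f : Module.End A U)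
    (hf : Continuous f) : ∃ e : Module.End A U, IsIdempotentElem e ∧
      (e : U → U) ∈ closure (Set.range fun n : ℕ => ((f ^ (n + 1) : Module.End A U) : U → U)) := by
  have : T2Space U := IsProfiniteModule.toT2Space A
  have : CompactSpace U := IsProfiniteModule.toCompactSpace A
  have : IsTopologicalAddGroup U := IsProfiniteModule.toIsTopologicalAddGroup A
  let _ : Semigroup (U → U) := { mul := fun g h => g ∘ h, mul_assoc := fun _ _ _ => rfl }
  let T : Set (U → U) := Set.range fun n : ℕ => ((f ^ (n + 1) : Module.End A U) : U → U)
  have hright : ∀ h : U → U, Continuous fun g : U → U => g * h := fun h =>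
    continuous_pi fun u => continuous_apply (h u)
  have hmul : ∀ g ∈ T, ∀ h ∈ T, g * h ∈ T := by
    rintro _ ⟨m, rfl⟩ _ ⟨n, rfl⟩
    refine ⟨m + 1 + n, ?_⟩
    change ((f ^ (m + 1 + n + 1) : Module.End A U) : U → U) = (f ^ (m + 1)) ∘ (f ^ (n + 1))
    rw [add_assoc (m + 1), pow_add f (m + 1)]
    rfl
  have hleft : ∀ g ∈ T, Continuous fun h : U → U => g * h := by
    rintro _ ⟨n, rfl⟩
    refine continuous_pi fun u => ?_
    have : Continuous ((f ^ (n + 1) : Module.End A U) : U → U) := by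
      rw [Module.End.coe_pow]
      exact hf.iterate _
    exact this.comp (continuous_apply u)
  -- Left translation by a limit need not be continuous, so the limits are taken one at a time.
  have hclosure₁ : ∀ g ∈ T, ∀ h ∈ closure T, g * h ∈ closure T := fun g hg h hh =>
    closure_minimal (t := {h : U → U | g * h ∈ closure T})
      (fun h hh => subset_closure (hmul g hg h hh)) (isClosed_closure.preimage (hleft g hg)) hh
  have hclosure₂ : ∀ g ∈ closure T, ∀ h ∈ closure T, g * h ∈ closure T := fun g hg h hh =>
    closure_minimal (t := {g : U → U | g * h ∈ closure T})
      (fun g hg => hclosure₁ g hg h hh) (isClosed_closure.preimage (hright h)) hg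
  obtain ⟨e, he, hee⟩ := exists_idempotent_in_compact_subsemigroup hright (closure T)
    (Set.range_nonempty _).closure isClosed_closure.isCompact hclosure₂
  have hadd : ∀ u v, e (u + v) = e u + e v := fun u v =>
    closure_minimal (t := {g : U → U | g (u + v) = g u + g v})
      (Set.range_subset_iff.2 fun n => map_add _ u v)
      (isClosed_eq (continuous_apply _) ((continuous_apply u).add (continuous_apply v))) he
  have hsmul : ∀ (a : A) u, e (a • u) = a • e u := fun a u =>
    closure_minimal (t := {g : U → U | g (a • u) = a • g u})
      (Set.range_subset_iff.2 fun n => map_smul _ a u)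
      (isClosed_eq (continuous_apply _) ((continuous_apply u).const_smul a)) he
  exact ⟨{ toFun := e, map_add' := hadd, map_smul' := hsmul },
    LinearMap.ext fun u => congrFun hee u, he⟩

/-- A substitute for Fitting's lemma: an idempotent limit `e` of the iterates of `f` is `0` or `1`.
If `e = 1`, then `f` is bijective; if `e = 0`, then `1 - f` is. -/
theorem Module.End.isUnit_or_isUnit_one_sub [Module.Finite A U]
    (hU : IsIndecomposableProfinite A U) (f : Module.End A U) : IsUnit f ∨ IsUnit (1 - f) := by
  have : T2Space U := IsProfiniteModule.toT2Space A
  have : CompactSpace U := IsProfiniteModule.toCompactSpace A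
  have : IsTopologicalAddGroup U := IsProfiniteModule.toIsTopologicalAddGroup A
  have hcont : ∀ g : Module.End A U, Continuous g :=
    fun g => LinearMap.continuous_of_finite_of_isProfiniteModule g
  have hrange : ∀ g : Module.End A U, IsClosed (LinearMap.range g : Set U) := fun g => by
    rw [LinearMap.coe_range]
    exact (isCompact_range (hcont g)).isClosed
  obtain ⟨e, he, hmem⟩ := exists_isIdempotentElem_mem_closure_iterate f (hcont f)
  have key : ∀ (u : U) (C : Set U), IsClosed C → (∀ n : ℕ, (f ^ (n + 1)) u ∈ C) → e u ∈ C := by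
    intro u C hC h
    have hC' : IsClosed {g : U → U | g u ∈ C} := hC.preimage (continuous_apply u)
    exact closure_minimal (t := {g : U → U | g u ∈ C}) (Set.range_subset_iff.2 h) hC' hmem
  have hker : IsClosed (LinearMap.ker e : Set U) := by
    convert (isClosed_singleton (x := (0 : U))).preimage (hcont e) using 1
    ext u
    simp
  rcases hU.2 _ _ (hrange e) hker
    (LinearMap.IsIdempotentElem.isCompl he) with h0 | h1
  · right
    have he0 : ∀ u, e u = 0 := fun u => by rw [LinearMap.range_eq_bot.1 h0, LinearMap.zero_apply]
    rw [Module.End.isUnit_iff]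
    refine ⟨(injective_iff_map_eq_zero _).2 fun u hu => ?_, fun u => ?_⟩
    · have hfu : f u = u := (sub_eq_zero.1 hu).symm
      have := key u {u} isClosed_singleton fun n => by
        rw [Module.End.pow_apply]
        exact Function.iterate_fixed hfu _
      rw [he0] at this
      exact (Set.mem_singleton_iff.1 this).symm
    · have := key u {v | u - v ∈ LinearMap.range (1 - f)}
        ((hrange (1 - f)).preimage (continuous_const.sub continuous_id)) fun n => by
          refine ⟨(∑ i ∈ Finset.range (n + 1), f ^ i) u, ?_⟩
          rw [← Module.End.mul_apply, mul_neg_geom_sum]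
          rfl
      rw [he0] at this
      simpa using this
  · left
    have he1 : ∀ u, e u = u := fun u => by
      refine LinearMap.ker_eq_bot.1 h1 ?_
      rw [← Module.End.mul_apply, he.eq]
    rw [Module.End.isUnit_iff]
    refine ⟨(injective_iff_map_eq_zero _).2 fun u hu => ?_, fun u => ?_⟩
    · have := key u {0} isClosed_singleton fun n => by
        rw [pow_succ, Module.End.mul_apply, hu, map_zero]
        rfl
      rwa [he1] at this
    · have := key u _ (hrange f) fun n => by
        rw [pow_succ', Module.End.mul_apply]
        exact ⟨_, rfl⟩
      rwa [he1] at this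

/-- The endomorphism ring is local: if a finite sum of endomorphisms is invertible, so is one of the
summands. -/
theorem Module.End.exists_isUnit_of_isUnit_sum [Module.Finite A U]
    (hU : IsIndecomposableProfinite A U) {ι : Type*} (s : Finset ι) (f : ι → Module.End A U)
    (h : IsUnit (∑ i ∈ s, f i)) : ∃ i ∈ s, IsUnit (f i) := by
  classical
  have := hU.1
  induction s using Finset.induction_on with
  | empty => exact absurd h (by simp)
  | insert i s hi ih =>
    rw [Finset.sum_insert hi] at h
    obtain ⟨u, hu⟩ := h
    have hsub : (1 : Module.End A U) - ↑u⁻¹ * f i = ↑u⁻¹ * ∑ j ∈ s, f j := by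
      rw [sub_eq_iff_eq_add', ← mul_add, ← hu, Units.inv_mul]
    rcases Module.End.isUnit_or_isUnit_one_sub hU (↑u⁻¹ * f i) with h | h
    · exact ⟨i, by simp, (Units.isUnit_units_mul _ _).1 h⟩
    · rw [hsub] at h
      obtain ⟨j, hj, hj'⟩ := ih ((Units.isUnit_units_mul _ _).1 h)
      exact ⟨j, by simp [hj], hj'⟩

end Fitting

/-! ### Relative projectivity for two open subgroups -/

section Mackey

open CompletedGroupAlgebra

variable {k : Type u} [Field k] [Finite k] {G : Type v} [Group G] [TopologicalSpace G]
  [IsTopologicalGroup G] [CompactSpace G]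
  {U : Type w} [AddCommGroup U] [Module (CompletedGroupAlgebra k G) U] [TopologicalSpace U]
  [IsProfiniteModule (CompletedGroupAlgebra k G) U]

/-- The other half of Higman's criterion, for a finite transitive `G`-set: if the sum of an
equivariant family of `k`-linear endomorphisms `γ_x` is invertible, then `U` is projective relative
to any subgroup that contains a point stabiliser. -/
theorem IsRelativelyProjective.of_isUnit_sum [Module.Finite (CompletedGroupAlgebra k G) U]
    {X : Type*} [Fintype X] [MulAction G X] [MulAction.IsPretransitive G X] (x₀ : X)
    {H : Subgroup G} (hH : ∀ g : G, g • x₀ = x₀ → g ∈ H) {γ : X → U →+ U}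
    (hc : ∀ x, Continuous (γ x)) (he : ∀ x, IsEquivariant k (⊥ : Subgroup G) (γ x))
    (hγ : ∀ (g : G) x, γ (g • x) = conjMap (k := k) g (γ x))
    {E : Module.End (CompletedGroupAlgebra k G) U} (hE : IsUnit E) (hsum : ∀ u, ∑ x, γ x u = E u)
    {K : Subgroup G} (hU : IsRelativelyProjective k K U) :
    IsRelativelyProjective k H U := by
  refine (hU.mono le_top).of_exists_lift fun φ β f hfc hfe hl => ?_
  obtain ⟨F, hF, hconj, -⟩ := exists_conjugate_family (MonoidHom.id G) x₀ hfe hH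
  have hsumE := isEquivariant_sum (MonoidHom.id G) (X := X) (f := fun x => (F x).comp (γ x))
    (fun x => by
      obtain ⟨g, hg⟩ := hF x
      exact (hg ▸ hfe.conjMap_bot g : IsEquivariant k (⊥ : Subgroup G) (F x)).comp (he x))
    (fun g x => by rw [hconj, hγ, conjMap_comp]; rfl)
  obtain ⟨E, rfl⟩ := hE
  let I : Module.End (CompletedGroupAlgebra k G) U := ↑E⁻¹
  refine ⟨(∑ x, (F x).comp (γ x)).comp I.toAddMonoidHom, ?_, ?_, fun u => ?_⟩
  · have hFc : Continuous fun u => ∑ x, F x (γ x u) := continuous_finsetSum _ fun x _ => by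
      obtain ⟨g, hg⟩ := hF x
      rw [hg]
      exact (continuous_conjMap g hfc).comp (hc x)
    have : IsTopologicalAddGroup U :=
      IsProfiniteModule.toIsTopologicalAddGroup (CompletedGroupAlgebra k G)
    have hI : Continuous I := LinearMap.continuous_of_finite_of_isProfiniteModule I
    convert hFc.comp hI using 1
    ext u
    simp
  · rw [← MonoidHom.range_eq_top.2 (fun g : G => ⟨g, rfl⟩ : Function.Surjective (MonoidHom.id G))]
    exact hsumE.comp (I.isEquivariant _)
  · have hFl : ∀ x v, β (F x v) = φ v := fun x v => by
      obtain ⟨g, hg⟩ := hF x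
      exact hg ▸ map_conjMap_of_lift (φ := φ.toLinearMap) (β := β.toLinearMap) hl g v
    simp only [AddMonoidHom.comp_apply, AddMonoidHom.finsetSum_apply, map_sum, hFl]
    rw [← map_sum, hsum]
    congr 1
    change ((E : Module.End (CompletedGroupAlgebra k G) U) * ↑E⁻¹) u = u
    rw [Units.mul_inv]
    rfl

/-- If `U` is projective relative to the open subgroups `H` and `K`, multiply the two expressions of
the identity as a trace and group the terms by the `G`-orbits on `G/H × G/K`. Each orbit contributes
an endomorphism, so one of these is invertible; the stabilisers of points of that orbit are the
conjugates of some `H ∩ gKg⁻¹`. -/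
theorem IsRelativelyProjective.exists_inf_conj [Module.Finite (CompletedGroupAlgebra k G) U]
    (hind : IsIndecomposableProfinite (CompletedGroupAlgebra k G) U) {H K : Subgroup G}
    (hH : IsOpen (H : Set G)) (hK : IsOpen (K : Set G)) (hUH : IsRelativelyProjective k H U)
    (hUK : IsRelativelyProjective k K U) :
    ∃ g : G, IsRelativelyProjective k (H ⊓ K.map (MulAut.conj g).toMonoidHom) U := by
  classical
  have : T2Space U := IsProfiniteModule.toT2Space (CompletedGroupAlgebra k G)
  have : IsTopologicalAddGroup U :=
    IsProfiniteModule.toIsTopologicalAddGroup (CompletedGroupAlgebra k G)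
  have : Finite (G ⧸ H) := Subgroup.quotient_finite_of_isOpen _ hH
  have : Finite (G ⧸ K) := Subgroup.quotient_finite_of_isOpen _ hK
  let _ : Fintype (G ⧸ H) := Fintype.ofFinite _
  let _ : Fintype (G ⧸ K) := Fintype.ofFinite _
  obtain ⟨γ, hγc, hγe, hγ, hγ1⟩ := hUH.exists_trace_family hH
  obtain ⟨δ, hδc, hδe, hδ, hδ1⟩ := hUK.exists_trace_family hK
  let ε : (G ⧸ H) × (G ⧸ K) → U →+ U := fun z => (γ z.1).comp (δ z.2)
  have hεc : ∀ z, Continuous (ε z) := fun z => (hγc z.1).comp (hδc z.2)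
  have hεe : ∀ z, IsEquivariant k (⊥ : Subgroup G) (ε z) := fun z => (hγe z.1).comp (hδe z.2)
  have hε : ∀ (g : G) z, ε (g • z) = conjMap (k := k) g (ε z) := fun g z => by
    change (γ (g • z.1)).comp (δ (g • z.2)) = _
    rw [hγ, hδ, ← conjMap_comp]
  have hε1 : ∀ u, ∑ z, ε z u = u := fun u => by
    have h1 : ∀ v, ∑ x, γ x v = v := fun v => by
      rw [← AddMonoidHom.finsetSum_apply, hγ1, AddMonoidHom.id_apply]
    have h2 : ∀ v, ∑ x, δ x v = v := fun v => by
      rw [← AddMonoidHom.finsetSum_apply, hδ1, AddMonoidHom.id_apply]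
    rw [Fintype.sum_prod_type_right]
    simp only [ε, AddMonoidHom.comp_apply, h1, h2]
  let Ω := MulAction.orbitRel.Quotient G ((G ⧸ H) × (G ⧸ K))
  let _ : Fintype Ω := Fintype.ofFinite _
  let E : Ω → Module.End (CompletedGroupAlgebra k G) U := fun ω =>
    { toFun := fun u => (∑ z : ω.orbit, ε z : U →+ U) u
      map_add' := map_add _
      map_smul' := fun a u => by
        have hE := isEquivariant_sum (MonoidHom.id G) (X := ω.orbit) (f := fun z => ε z)
          (fun z => hεe z) (fun g z => hε g z)
        rw [MonoidHom.range_eq_top.2 (fun g : G => ⟨g, rfl⟩ :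
          Function.Surjective (MonoidHom.id G))] at hE
        refine hE.map_smul ?_ a u
        have : Continuous fun u => ∑ z : ω.orbit, ε z u :=
          continuous_finsetSum _ fun z _ => hεc z
        convert this using 2 with u
        simp }
  have hEapply : ∀ ω u, E ω u = ∑ z : ω.orbit, ε z u := fun ω u =>
    AddMonoidHom.finsetSum_apply _ _ _
  have hE1 : ∑ ω, E ω = 1 := by
    ext u
    rw [LinearMap.sum_apply, Module.End.one_apply]
    simp only [hEapply]
    rw [← Fintype.sum_sigma' (fun (ω : Ω) (z : ω.orbit) => ε z u)]
    rw [← Equiv.sum_comp (MulAction.selfEquivSigmaOrbits' G ((G ⧸ H) × (G ⧸ K)))]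
    exact hε1 u
  obtain ⟨ω, -, hω⟩ := Module.End.exists_isUnit_of_isUnit_sum hind Finset.univ E
    (hE1 ▸ isUnit_one)
  -- Since `G` is transitive on `G/H`, the orbit contains a point whose first coordinate is `H`.
  obtain ⟨g, hg⟩ : ∃ g : G, (((1 : G) : G ⧸ H), (g : G ⧸ K)) ∈ ω.orbit := by
    induction ω using Quotient.inductionOn' with
    | h z =>
      obtain ⟨x, y⟩ := z
      obtain ⟨a, rfl⟩ := QuotientGroup.mk_surjective x
      obtain ⟨b, rfl⟩ := QuotientGroup.mk_surjective y
      refine ⟨a⁻¹ * b, a⁻¹, ?_⟩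
      change (((a⁻¹ * a : G) : G ⧸ H), ((a⁻¹ * b : G) : G ⧸ K)) = _
      rw [inv_mul_cancel]
  have htrans : MulAction.IsPretransitive G ω.orbit := by
    induction ω using Quotient.inductionOn' with
    | h z => exact inferInstanceAs (MulAction.IsPretransitive G (MulAction.orbit G z))
  refine ⟨g, .of_isUnit_sum (⟨_, hg⟩ : ω.orbit) (fun s hs => ?_) (γ := fun z => ε z)
    (fun z => hεc z) (fun z => hεe z) (fun g z => hε g z) hω (fun u => (hEapply ω u).symm) hUH⟩
  have hs' := congrArg Subtype.val hs
  have h1 : ((s * 1 : G) : G ⧸ H) = (1 : G) := congrArg Prod.fst hs'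
  have h2 : ((s * g : G) : G ⧸ K) = g := congrArg Prod.snd hs'
  refine ⟨?_, g⁻¹ * (s * g), QuotientGroup.eq.1 h2.symm, ?_⟩
  · simpa using QuotientGroup.eq.1 h1.symm
  · simp [mul_assoc]

end Mackey

/-! ### Relative projectivity and approximation by open subgroups -/

section Approximation

section OpenSubmodule

variable {A : Type*} [Ring A] [TopologicalSpace A]
  {U : Type*} [AddCommGroup U] [Module A U] [TopologicalSpace U] [IsProfiniteModule A U]

/-- The open submodules form a neighbourhood basis of zero. -/
theorem exists_isOpen_submodule_subset [CompactSpace A] {O : Set U} (hO : O ∈ 𝓝 (0 : U)) :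
    ∃ S : Submodule A U, IsOpen (S : Set U) ∧ (S : Set U) ⊆ O := by
  have : TotallyDisconnectedSpace U := IsProfiniteModule.toTotallyDisconnectedSpace A
  have : CompactSpace U := IsProfiniteModule.toCompactSpace A
  have : T2Space U := IsProfiniteModule.toT2Space A
  have : IsTopologicalAddGroup U := IsProfiniteModule.toIsTopologicalAddGroup A
  obtain ⟨B, hB⟩ := ProfiniteGrp.exist_openNormalAddSubgroup_sub_open_nhds_of_zero
    (isOpen_interior (s := O)) (mem_interior_iff_mem_nhds.2 hO)
  let S : Submodule A U :=
    { carrier := {u | ∀ a : A, a • u ∈ B}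
      zero_mem' := fun a => by rw [smul_zero]; exact zero_mem B
      add_mem' := fun hu hv a => by rw [smul_add]; exact add_mem (hu a) (hv a)
      smul_mem' := fun b u hu a => by rw [smul_smul]; exact hu _ }
  refine ⟨S, ?_, fun u hu => interior_subset (hB ?_)⟩
  -- The complement is the projection of a closed subset of `A × U` along the compact factor `A`.
  · have hcl : IsClosed {x : A × U | x.1 • x.2 ∉ B} :=
      (B.isOpen'.preimage continuous_smul).isClosed_compl
    have : (S : Set U) = (Prod.snd '' {x : A × U | x.1 • x.2 ∉ B})ᶜ := by
      ext u
      simp [S]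
    rw [this]
    exact (isClosedMap_snd_of_compactSpace _ hcl).isOpen_compl
  · have := hu 1
    rwa [one_smul] at this

theorem IsProfiniteModule.quotient {S : Submodule A U} (hS : IsOpen (S : Set U)) :
    IsProfiniteModule A (U ⧸ S) := by
  have : CompactSpace U := IsProfiniteModule.toCompactSpace A
  have : IsTopologicalAddGroup U := IsProfiniteModule.toIsTopologicalAddGroup A
  have : DiscreteTopology (U ⧸ S) := QuotientAddGroup.discreteTopology (N := S.toAddSubgroup) hS
  have : CompactSpace (U ⧸ S) := Quotient.compactSpace
  exact {}

end OpenSubmodule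

open CompletedGroupAlgebra

variable {k : Type u} [Field k] {G : Type v} [Group G] [TopologicalSpace G]
  [IsTopologicalGroup G] [CompactSpace G] [TotallyDisconnectedSpace G]
  {U : Type w} [AddCommGroup U] [Module (CompletedGroupAlgebra k G) U] [TopologicalSpace U]
  [IsProfiniteModule (CompletedGroupAlgebra k G) U]

/-- Some open normal subgroup acts trivially on the quotient by an open submodule. -/
theorem exists_openNormalSubgroup_smul_sub_mem {S : Submodule (CompletedGroupAlgebra k G) U}
    (hS : IsOpen (S : Set U)) :
    ∃ N : OpenNormalSubgroup G, ∀ n ∈ N, ∀ u : U, of k n • u - u ∈ S := by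
  have : CompactSpace U := IsProfiniteModule.toCompactSpace (CompletedGroupAlgebra k G)
  have : IsTopologicalAddGroup U :=
    IsProfiniteModule.toIsTopologicalAddGroup (CompletedGroupAlgebra k G)
  have hcont : Continuous fun x : U × G => of k x.2 • x.1 - x.1 :=
    (((continuous_of k).comp continuous_snd).smul continuous_fst).sub continuous_fst
  have hcl : IsClosed {x : U × G | of k x.2 • x.1 - x.1 ∉ S} :=
    (hS.preimage hcont).isClosed_compl
  have hopen : IsOpen {g : G | ∀ u : U, of k g • u - u ∈ S} := by
    have : {g : G | ∀ u : U, of k g • u - u ∈ S} =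
        (Prod.snd '' {x : U × G | of k x.2 • x.1 - x.1 ∉ S})ᶜ := by
      ext g
      simp
    rw [this]
    exact (isClosedMap_snd_of_compactSpace _ hcl).isOpen_compl
  obtain ⟨N, hN⟩ := ProfiniteGrp.exist_openNormalSubgroup_sub_open_nhds_of_one hopen fun u => by
    rw [map_one, one_smul, sub_self]
    exact S.zero_mem
  exact ⟨N, fun n hn => hN hn⟩

/-- Modulo an open submodule, an `H`-equivariant map becomes equivariant for `HN` with `N` open. -/
theorem IsEquivariant.exists_mkQ_comp [Finite k] {V : Type*} [AddCommGroup V]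
    [Module (CompletedGroupAlgebra k G) V] [TopologicalSpace V]
    [IsProfiniteModule (CompletedGroupAlgebra k G) V] {H : Subgroup G} {f : U →+ V}
    (hf : IsEquivariant k H f) (hc : Continuous f) {S : Submodule (CompletedGroupAlgebra k G) V}
    (hS : IsOpen (S : Set V)) :
    ∃ N : OpenNormalSubgroup G,
      IsEquivariant k (H ⊔ (N : Subgroup G)) (S.mkQ.toAddMonoidHom.comp f) := by
  obtain ⟨T, hT, hTS⟩ := exists_isOpen_submodule_subset (A := CompletedGroupAlgebra k G)
    ((hS.preimage hc).mem_nhds (by simp) : f ⁻¹' (S : Set V) ∈ 𝓝 0)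
  obtain ⟨N₁, hN₁⟩ := exists_openNormalSubgroup_smul_sub_mem hT
  obtain ⟨N₂, hN₂⟩ := exists_openNormalSubgroup_smul_sub_mem hS
  refine ⟨N₁ ⊓ N₂, fun c u => ?_, fun g hg u => ?_⟩
  · exact (S.mkQ.isEquivariant H |>.comp hf).1 c u
  · obtain ⟨h, hh, n, hn, rfl⟩ := Subgroup.mem_sup_of_normal_right.1 hg
    have h1 : f (of k n • u) - f u ∈ S := by
      rw [← map_sub]
      exact hTS (hN₁ n hn.1 u)
    have h2 : of k n • f u - f u ∈ S := hN₂ n hn.2 _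
    have h3 : S.mkQ (f (of k n • u)) = S.mkQ (of k n • f u) := by
      rw [← sub_eq_zero, ← map_sub]
      refine (Submodule.Quotient.mk_eq_zero S).2 ?_
      simpa using S.sub_mem h1 h2
    change S.mkQ (f (of k (h * n) • u)) = of k (h * n) • S.mkQ (f u)
    rw [map_mul, mul_smul, hf.2 h hh, S.mkQ.map_smul, h3, S.mkQ.map_smul, mul_smul]

/-- A finitely generated module that is projective relative to `HN` for all open normal subgroups
`N` is projective relative to `H`. Given a lift over `H`, there are `G`-equivariant lifts modulo
every open submodule of `V`; as `U` is finitely generated, a homomorphism is given by finitely many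
elements of `V`, and a compactness argument yields a lift to `V`. -/
theorem IsRelativelyProjective.of_forall_sup [Finite k]
    [Module.Finite (CompletedGroupAlgebra k G) U] {H : Subgroup G}
    (hU : ∀ N : OpenNormalSubgroup G, IsRelativelyProjective k (H ⊔ (N : Subgroup G)) U) :
    IsRelativelyProjective k H U := by
  intro V W _ _ _ _ _ _ _ _ φ β hβ ⟨f, hc, he, hl⟩
  have hf : IsEquivariant k H f := isEquivariant_of_map_inclusion_smul he
  set A := CompletedGroupAlgebra k G
  have : IsTopologicalAddGroup U := IsProfiniteModule.toIsTopologicalAddGroup A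
  have : CompactSpace V := IsProfiniteModule.toCompactSpace A
  have : T2Space V := IsProfiniteModule.toT2Space A
  have : IsTopologicalAddGroup V := IsProfiniteModule.toIsTopologicalAddGroup A
  have : T2Space W := IsProfiniteModule.toT2Space A
  have : IsTopologicalAddGroup W := IsProfiniteModule.toIsTopologicalAddGroup A
  obtain ⟨n, π, hπ⟩ := Module.Finite.exists_fin' A U
  let Ψ (v : Fin n → V) : (Fin n → A) →ₗ[A] V := Fintype.linearCombination A v
  have hΨ : ∀ a : Fin n → A, Continuous fun v => Ψ v a := fun a => by
    simp only [Ψ, Fintype.linearCombination_apply]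
    fun_prop
  let ι := {S : Submodule A V // IsOpen (S : Set V)}
  have hclosed : ∀ S : ι, IsClosed (S.1 : Set V) := fun S =>
    S.1.toAddSubgroup.isClosed_of_isOpen S.2
  have hclosed' : ∀ S : ι, IsClosed ((S.1.map β.toLinearMap : Submodule A W) : Set W) := fun S =>
    ((hclosed S).isCompact.image β.continuous).isClosed
  -- The candidates for the images of the generators under the lifts modulo `S`.
  let L (S : ι) : Set (Fin n → V) :=
    {v | ∀ a, (π a = 0 → Ψ v a ∈ S.1) ∧ β (Ψ v a) - φ (π a) ∈ S.1.map β.toLinearMap}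
  have hLclosed : ∀ S, IsClosed (L S) := fun S => by
    have : L S = ⋂ a, ({v | π a = 0 → Ψ v a ∈ S.1} ∩
        {v | β (Ψ v a) - φ (π a) ∈ S.1.map β.toLinearMap}) := by
      ext v
      simp [L]
    rw [this]
    refine isClosed_iInter fun a => IsClosed.inter ?_ ?_
    · by_cases ha : π a = 0
      · simp only [ha, true_imp_iff]
        exact (hclosed S).preimage (hΨ a)
      · simp [ha]
    · exact (hclosed' S).preimage ((β.continuous.comp (hΨ a)).sub continuous_const)
  have hLne : ∀ S, (L S).Nonempty := fun S => by
    have hβopen : IsOpen ((S.1.map β.toLinearMap : Submodule A W) : Set W) := by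
      have hq : IsQuotientMap β := β.continuous.isClosedMap.isQuotientMap β.continuous hβ
      rw [← hq.isOpen_preimage]
      exact AddSubgroup.isOpen_mono (H₁ := S.1.toAddSubgroup)
        (H₂ := ((S.1.map β.toLinearMap).comap β.toLinearMap).toAddSubgroup)
        (fun v hv => ⟨v, hv, rfl⟩) S.2
    have hV : IsProfiniteModule A (V ⧸ S.1) := .quotient S.2
    have hW : IsProfiniteModule A (W ⧸ S.1.map β.toLinearMap) := .quotient hβopen
    obtain ⟨N, hN⟩ := hf.exists_mkQ_comp hc S.2
    let β' : (V ⧸ S.1) →L[A] (W ⧸ S.1.map β.toLinearMap) :=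
      { toLinearMap := S.1.mapQ _ β.toLinearMap (Submodule.le_comap_map _ _)
        cont := S.1.isQuotientMap_mkQ.continuous_iff.2
          ((Submodule.isQuotientMap_mkQ _).continuous.comp β.continuous) }
    let φ' : U →L[A] (W ⧸ S.1.map β.toLinearMap) :=
      { toLinearMap := (Submodule.mkQ _).comp φ.toLinearMap
        cont := (Submodule.isQuotientMap_mkQ _).continuous.comp φ.continuous }
    have hβ' : Function.Surjective β' := fun w => by
      obtain ⟨w, rfl⟩ := Submodule.mkQ_surjective _ w
      obtain ⟨v, rfl⟩ := hβ w
      exact ⟨S.1.mkQ v, rfl⟩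
    obtain ⟨ρ, hρ⟩ := (hU N).exists_lift (φ := φ') hβ' _
      (S.1.isQuotientMap_mkQ.continuous.comp hc) hN fun u => by
        change Submodule.mkQ _ (β (f u)) = _
        rw [hl]
        rfl
    choose v hv using fun i => S.1.mkQ_surjective (ρ (π (Pi.single i 1)))
    have hvΨ : ∀ a, S.1.mkQ (Ψ v a) = ρ (π a) := by
      have : S.1.mkQ.comp (Ψ v) = ρ.toLinearMap.comp π := by
        refine LinearMap.pi_ext' fun i => LinearMap.ext_ring ?_
        simpa [Ψ] using hv i
      exact fun a => LinearMap.congr_fun this a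
    refine ⟨v, fun a => ⟨fun ha => ?_, ?_⟩⟩
    · rw [← Submodule.Quotient.mk_eq_zero, ← Submodule.mkQ_apply, hvΨ, ha, map_zero]
    · rw [← Submodule.Quotient.mk_eq_zero, Submodule.Quotient.mk_sub, sub_eq_zero]
      have := hρ (π a)
      rw [← hvΨ] at this
      exact this
  have hdir : Directed (· ⊇ ·) L := by
    intro S T
    refine ⟨⟨S.1 ⊓ T.1, S.2.inter T.2⟩, fun v hv a => ⟨fun ha => ((hv a).1 ha).1, ?_⟩,
      fun v hv a => ⟨fun ha => ((hv a).1 ha).2, ?_⟩⟩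
    · exact Submodule.map_mono inf_le_left (hv a).2
    · exact Submodule.map_mono inf_le_right (hv a).2
  have : Nonempty ι := ⟨⊤, isOpen_univ⟩
  obtain ⟨v, hv⟩ := IsCompact.nonempty_iInter_of_directed_nonempty_isCompact_isClosed L hdir hLne
    (fun S => (hLclosed S).isCompact) hLclosed
  have hv' : ∀ S, v ∈ L S := Set.mem_iInter.1 hv
  have hker : LinearMap.ker π ≤ LinearMap.ker (Ψ v) := fun a ha => by
    by_contra hne
    obtain ⟨S, hS, hS'⟩ := exists_isOpen_submodule_subset (A := A) (O := {Ψ v a}ᶜ)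
      (isOpen_compl_singleton.mem_nhds (Ne.symm hne))
    exact hS' ((hv' ⟨S, hS⟩ a).1 ha) rfl
  have hlift : ∀ a, β (Ψ v a) = φ (π a) := fun a => by
    by_contra hne
    obtain ⟨S, hS, hS'⟩ := exists_isOpen_submodule_subset (A := A) (O := {β (Ψ v a) - φ (π a)}ᶜ)
      (isOpen_compl_singleton.mem_nhds (Ne.symm (sub_ne_zero.2 hne)))
    obtain ⟨x, hx, hx'⟩ := (hv' ⟨S.comap β.toLinearMap, hS.preimage β.continuous⟩ a).2
    exact hS' hx hx'
  let ρ : U →ₗ[A] V :=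
    ((LinearMap.ker π).liftQ (Ψ v) hker).comp (π.quotKerEquivOfSurjective hπ).symm.toLinearMap
  have hρ : ∀ a, ρ (π a) = Ψ v a := fun a => by
    have : (π.quotKerEquivOfSurjective hπ).symm (π a) = (LinearMap.ker π).mkQ a := by
      rw [LinearEquiv.symm_apply_eq]
      rfl
    simp [ρ, this]
  refine ⟨⟨ρ, LinearMap.continuous_of_finite_of_isProfiniteModule ρ⟩, fun u => ?_⟩
  obtain ⟨a, rfl⟩ := hπ u
  exact (congrArg β (hρ a)).trans (hlift a)

end Approximation

/-! ### Conjugacy of vertices -/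

section Conjugacy

open CompletedGroupAlgebra

variable {k : Type u} [Field k] [Finite k] {G : Type v} [Group G] [TopologicalSpace G]
  [IsTopologicalGroup G] [CompactSpace G] [T2Space G] [TotallyDisconnectedSpace G]
  {U : Type w} [AddCommGroup U] [Module (CompletedGroupAlgebra k G) U] [TopologicalSpace U]
  [IsProfiniteModule (CompletedGroupAlgebra k G) U]

omit [CompactSpace G] [T2Space G] [TotallyDisconnectedSpace G] in
theorem isOpen_sup_openNormalSubgroup (H : Subgroup G) (N : OpenNormalSubgroup G) :
    IsOpen ((H ⊔ (N : Subgroup G) : Subgroup G) : Set G) :=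
  Subgroup.isOpen_mono le_sup_right N.isOpen'

omit [T2Space G] in
theorem mem_of_forall_mem_sup {H : Subgroup G} (hH : IsClosed (H : Set G)) {g : G}
    (hg : ∀ N : OpenNormalSubgroup G, g ∈ H ⊔ (N : Subgroup G)) : g ∈ H := by
  by_contra hne
  have hopen : IsOpen {n : G | g * n⁻¹ ∉ H} :=
    hH.isOpen_compl.preimage (continuous_const.mul continuous_inv)
  obtain ⟨N, hN⟩ := ProfiniteGrp.exist_openNormalSubgroup_sub_open_nhds_of_one hopen (by simpa)
  obtain ⟨h, hh, n, hn, rfl⟩ := Subgroup.mem_sup_of_normal_right.1 (hg N)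
  exact hN hn (by simpa using hh)

omit [TotallyDisconnectedSpace G] in
theorem isClosed_map_conj {H : Subgroup G} (hH : IsClosed (H : Set G)) (g : G) :
    IsClosed ((H.map (MulAut.conj g).toMonoidHom : Subgroup G) : Set G) := by
  refine (hH.isCompact.image (f := fun x => g * x * g⁻¹) (by fun_prop)).isClosed

/-- If `U` is projective relative to the closed subgroups `Q` and `R`, then also relative to
`Q ∩ xRx⁻¹` for some `x`. For each open normal subgroup `N` the elements `x` that work for `QN` and
`RN` form a non-empty union of cosets of `N`; these sets decrease with `N`, and by compactness some
`x` works for all of them. -/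
theorem IsRelativelyProjective.exists_inf_conj_of_isClosed
    [Module.Finite (CompletedGroupAlgebra k G) U]
    (hind : IsIndecomposableProfinite (CompletedGroupAlgebra k G) U) {Q R : Subgroup G}
    (hQ : IsClosed (Q : Set G)) (hR : IsClosed (R : Set G)) (hUQ : IsRelativelyProjective k Q U)
    (hUR : IsRelativelyProjective k R U) :
    ∃ x : G, IsRelativelyProjective k (Q ⊓ R.map (MulAut.conj x).toMonoidHom) U := by
  let I (N : OpenNormalSubgroup G) (x : G) : Subgroup G :=
    (Q ⊔ (N : Subgroup G)) ⊓ (R ⊔ (N : Subgroup G)).map (MulAut.conj x).toMonoidHom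
  let X (N : OpenNormalSubgroup G) : Set G := {x | IsRelativelyProjective k (I N x) U}
  have hIclosed : ∀ N x, IsClosed (I N x : Set G) := fun N x =>
    (Subgroup.isClosed_of_isOpen _ (isOpen_sup_openNormalSubgroup Q N)).inter
      (isClosed_map_conj (Subgroup.isClosed_of_isOpen _ (isOpen_sup_openNormalSubgroup R N)) x)
  have hImono : ∀ {N M : OpenNormalSubgroup G}, N ≤ M → ∀ x, I N x ≤ I M x := fun {N M} h x =>
    have h' : (N : Subgroup G) ≤ M := h
    inf_le_inf (sup_le_sup_left h' Q) (Subgroup.map_mono (sup_le_sup_left h' R))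
  have hXne : ∀ N, (X N).Nonempty := fun N =>
    (hUQ.mono le_sup_left).exists_inf_conj hind (isOpen_sup_openNormalSubgroup Q N)
      (isOpen_sup_openNormalSubgroup R N) (hUR.mono le_sup_left)
  have hXcoset : ∀ N x, ∀ n ∈ N, I N (x * n) = I N x := fun N x n hn => by
    have : (R ⊔ (N : Subgroup G)).map (MulAut.conj n).toMonoidHom = R ⊔ (N : Subgroup G) :=
      Subgroup.conj_smul_eq_self_of_mem (le_sup_right (a := R) hn)
    simp only [I]
    conv_rhs => rw [← this, Subgroup.map_map]
    congr 2
    ext y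
    simp
  have hXclosed : ∀ N, IsClosed (X N) := fun N => by
    refine ⟨isOpen_iff_mem_nhds.2 fun x hx => ?_⟩
    have hopen : IsOpen {y : G | x⁻¹ * y ∈ N} := N.isOpen'.preimage (continuous_const_mul x⁻¹)
    filter_upwards [hopen.mem_nhds (by simp [one_mem])] with y hy hyX
    refine hx ?_
    have := hXcoset N x _ hy
    rw [mul_inv_cancel_left] at this
    change IsRelativelyProjective k (I N x) U
    rw [← this]
    exact hyX
  have hdir : Directed (· ⊇ ·) X := fun N M =>
    ⟨N ⊓ M, fun x hx => IsRelativelyProjective.mono hx (hImono inf_le_left x),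
      fun x hx => IsRelativelyProjective.mono hx (hImono inf_le_right x)⟩
  obtain ⟨x, hx⟩ := IsCompact.nonempty_iInter_of_directed_nonempty_isCompact_isClosed X hdir hXne
    (fun N => (hXclosed N).isCompact) hXclosed
  have hx' : ∀ N, IsRelativelyProjective k (I N x) U := Set.mem_iInter.1 hx
  refine ⟨x, .of_forall_sup fun M => ?_⟩
  -- By compactness `QN ∩ xRNx⁻¹` lies in the open set `(Q ∩ xRx⁻¹)M` for some `N`.
  obtain ⟨N, hN⟩ := exists_subset_nhds_of_isCompact' (V := fun N => (I N x : Set G))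
    (fun N M => ⟨N ⊓ M, hImono inf_le_left x, hImono inf_le_right x⟩)
    (fun N => (hIclosed N x).isCompact) (fun N => hIclosed N x)
    (U := ((Q ⊓ R.map (MulAut.conj x).toMonoidHom ⊔ (M : Subgroup G) : Subgroup G) : Set G))
    fun g hg => (isOpen_sup_openNormalSubgroup _ M).mem_nhds <| by
      have hg' : ∀ N, g ∈ I N x := Set.mem_iInter.1 hg
      refine Subgroup.mem_sup_left ⟨mem_of_forall_mem_sup hQ fun N => (hg' N).1,
        x⁻¹ * g * x, mem_of_forall_mem_sup hR fun N => ?_, ?_⟩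
      · obtain ⟨y, hy, rfl⟩ := (hg' N).2
        simpa [mul_assoc] using hy
      · simp [mul_assoc]
  exact (hx' N).mono hN

/-- Both inclusions `Q ∩ xRx⁻¹ ≤ Q` and `x⁻¹Qx ≤ R` are equalities by minimality. -/
theorem IsVertex.exists_eq_map_conj [Module.Finite (CompletedGroupAlgebra k G) U]
    (hind : IsIndecomposableProfinite (CompletedGroupAlgebra k G) U) {Q R : Subgroup G}
    (hQ : IsVertex k Q U) (hR : IsVertex k R U) :
    ∃ x : G, Q = R.map (MulAut.conj x).toMonoidHom := by
  obtain ⟨hQc, hQp, hQm⟩ := hQ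
  obtain ⟨hRc, hRp, hRm⟩ := hR
  obtain ⟨x, hx⟩ := hQp.exists_inf_conj_of_isClosed hind hQc hRc hRp
  have hle : Q ≤ R.map (MulAut.conj x).toMonoidHom := by
    by_contra hne
    exact hQm _ (hQc.inter (isClosed_map_conj hRc x)) (inf_lt_left.2 hne) hx
  have hcancel : ∀ (g : G) (H : Subgroup G), (H.map (MulAut.conj g).toMonoidHom).map
      (MulAut.conj g⁻¹).toMonoidHom = H := fun g H => by
    rw [Subgroup.map_map]
    convert H.map_id
    ext y
    simp [mul_assoc]
  have hle' : Q.map (MulAut.conj x⁻¹).toMonoidHom ≤ R := by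
    rw [← hcancel x R]
    exact Subgroup.map_mono hle
  have heq : Q.map (MulAut.conj x⁻¹).toMonoidHom = R := by
    by_contra hne
    exact hRm _ (isClosed_map_conj hQc x⁻¹) (lt_of_le_of_ne hle' hne) (hQp.conj x⁻¹)
  refine ⟨x, ?_⟩
  rw [← heq]
  simpa using (hcancel x⁻¹ Q).symm

end Conjugacy

theorem mainTheorem2
    (p : ℕ) [Fact p.Prime]
    (k : Type u) [Field k] [Finite k] [CharP k p]
    (G : Type v) [Group G] [TopologicalSpace G] [IsTopologicalGroup G]
    [CompactSpace G] [T2Space G] [TotallyDisconnectedSpace G]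
    (U : Type w) [AddCommGroup U] [Module (CompletedGroupAlgebra k G) U] [TopologicalSpace U]
    [IsProfiniteModule (CompletedGroupAlgebra k G) U]
    (hfg : Module.Finite (CompletedGroupAlgebra k G) U)
    (hind : IsIndecomposableProfinite (CompletedGroupAlgebra k G) U) :
    (∀ Q R : Subgroup G, IsVertex k Q U → IsVertex k R U →
      ∃ x : G, Q = R.map (MulAut.conj x).toMonoidHom) ∧
    (∀ Q : Subgroup G, IsVertex k Q U → IsProP p Q) :=
  ⟨fun _ _ hQ hR => hQ.exists_eq_map_conj hind hR, fun _ hQ => hQ.isProP p⟩
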